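/- Let $\Theta=(\alpha,\beta)$ be a bounded open interval and $T>0$. For $\varepsilon>0$ and a true value $\theta\in\Theta$, let the observed process $X$ and the hidden process $Y$ solve, on $[0,T]$, $$dX_t=f(\theta,t)Y_t\,dt+\varepsilon\sigma(t)\,dW_t,\quad X_0=0,\qquad dY_t=a(\theta,t)Y_t\,dt+\varepsilon b(t)\,dV_t,\quad Y_0=y_0,$$ where $W,V$ are independent Wiener processes; $P_\theta$ and $E_\theta$ denote the corresponding probability and expectation (for noise level $\varepsilon$). A dot denotes $\partial/\partial\theta$ and a prime $\partial/\partial t$. Assume Conditions $\mathscr R$: * $f,a$ are bounded on $\Theta\times[0,T]$, $\sigma,b$ are bounded on $[0,T]$ (and all are measurable in $t$); * $f$ and $a$ are continuously differentiable in $\theta$, $\dot f$ is continuously differentiable in $t$, and $\dot a$ and $\dot f'$ are bounded on $\Theta\times[0,T]$; * $\inf_{\theta\in\Theta}|f(\theta,0)|>0$ and $\inf_{\theta\in\Theta}|\dot f(\theta,0)|>0$; * $y_0\neq0$. Let $x_t(\theta)=\int_0^t f(\theta,s)\,y_s(\theta)\,ds$ with $y_t(\theta)=y_0\exp\{\int_0^t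 a(\theta,r)\,dr\}$ be the solution for $\varepsilon=0$, and let $x_m(t)=\inf_{\theta\in\Theta}x_t(\theta)$, $x_M(t)=\sup_{\theta\in\Theta}x_t(\theta)$. Let $\delta\in(0,2)$ and $\tau_\varepsilon=\varepsilon^\delta$. The preliminary estimator $\bar\theta_{\tau_\varepsilon}$ is the solution $\mu\in\Theta$ of $x_{\tau_\varepsilon}(\mu)=X_{\tau_\varepsilon}$ if $x_m(\tau_\varepsilon)<X_{\tau_\varepsilon}<x_M(\tau_\varepsilon)$; it equals $\alpha$ if $X_{\tau_\varepsilon}\le x_m(\tau_\varepsilon)$ and $\beta$ if $X_{\tau_\varepsilon}\ge x_M(\tau_\varepsilon)$ when $y_0\dot f(\cdot,0)>0$ on $\Theta$, with $\alpha$ and $\beta$ exchanged when $y_0\dot f(\cdot,0)<0$ on $\Theta$ (one of the two cases always holds). Then there is $\varepsilon_0>0$ such that for all $\varepsilon\in(0,\varepsilon_0)$ we have $\tau_\varepsilon\le T$, the equation $x_{\tau_\varepsilon}(\mu)=z$ has exactly one solution $\mu\in\Theta$ for each $z\in(x_m(\tau_\varepsilon),x_M(\tau_\varepsilon))$, and the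 estimator is a measurable function of $X_{\tau_\varepsilon}$; and for every compact $K\subset\Theta$: 1. (uniform consistency) for every $\nu>0$, $\ \sup_{\theta_0\in K}P_{\theta_0}\left(|\bar\theta_{\tau_\varepsilon}-\theta_0|>\nu\right)\to0$ as $\varepsilon\to0$; 2. (rate) for every $p>0$ there is a constant $C>0$ such that for all $\varepsilon\in(0,\varepsilon_0)$ $$\sup_{\theta_0\in K}E_{\theta_0}|\bar\theta_{\tau_\varepsilon}-\theta_0|^p\le C\left(\frac{\varepsilon}{\sqrt{\tau_\varepsilon}}\right)^p,$$ and the right-hand side tends to $0$ as $\varepsilon\to0$. -/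

import Mathlib

open MeasureTheory ProbabilityTheory Filter Topology Set
open scoped ENNReal NNReal

universe u

noncomputable section

namespace HiddenGaussian

/-- The known ingredients of the partially observed linear system
`dX = f(θ,t) Y dt + ε σ(t) dW`, `X₀ = 0`, `dY = a(θ,t) Y dt + ε b(t) dV`, `Y₀ = y₀`,
on `[0,T]`, with parameter set `Θ = (α,β)`. -/
structure Model where
  α : ℝ
  β : ℝ
  T : ℝ
  y₀ : ℝ
  f : ℝ → ℝ → ℝ
  a : ℝ → ℝ → ℝ
  σ : ℝ → ℝ
  b : ℝ → ℝ

namespace Model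

variable (S : Model)

/-- The parameter set, an open bounded interval. -/
def Θ : Set ℝ := Ioo S.α S.β

/-- The derivative of `f` with respect to the parameter. -/
def fDot (θ t : ℝ) : ℝ := deriv (fun u => S.f u t) θ

/-- The derivative of `a` with respect to the parameter. -/
def aDot (θ t : ℝ) : ℝ := deriv (fun u => S.a u t) θ

/-- The regularity conditions on the model. -/
structure Regular : Prop where
  α_lt_β : S.α < S.β
  T_pos : 0 < S.T
  -- measurability in time
  measurable_f : ∀ θ ∈ S.Θ, Measurable (S.f θ)
  measurable_a : ∀ θ ∈ S.Θ, Measurable (S.a θ)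
  measurable_σ : Measurable S.σ
  measurable_b : Measurable S.b
  -- boundedness of the coefficients
  bounded_f : ∃ B, ∀ θ ∈ S.Θ, ∀ t ∈ Icc 0 S.T, |S.f θ t| ≤ B
  bounded_a : ∃ B, ∀ θ ∈ S.Θ, ∀ t ∈ Icc 0 S.T, |S.a θ t| ≤ B
  bounded_σ : ∃ B, ∀ t ∈ Icc 0 S.T, |S.σ t| ≤ B
  bounded_b : ∃ B, ∀ t ∈ Icc 0 S.T, |S.b t| ≤ B
  -- `f` and `a` are continuously differentiable in the parameter, with `aDot` bounded
  contDiff_f : ∀ t ∈ Icc 0 S.T, ContDiffOn ℝ 1 (fun θ => S.f θ t) S.Θ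
  contDiff_a : ∀ t ∈ Icc 0 S.T, ContDiffOn ℝ 1 (fun θ => S.a θ t) S.Θ
  bounded_aDot : ∃ B, ∀ θ ∈ S.Θ, ∀ t ∈ Icc 0 S.T, |S.aDot θ t| ≤ B
  -- `fDot` is continuously differentiable in time, with bounded derivative
  contDiff_fDot : ∀ θ ∈ S.Θ, ContDiffOn ℝ 1 (fun t => S.fDot θ t) (Icc 0 S.T)
  bounded_fDot' : ∃ B, ∀ θ ∈ S.Θ, ∀ t ∈ Icc 0 S.T,
    |derivWithin (fun s => S.fDot θ s) (Icc 0 S.T) t| ≤ B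
  -- `f(·,0)` and `fDot(·,0)` are separated from zero
  f_zero_sep : ∃ c > 0, ∀ θ ∈ S.Θ, c ≤ |S.f θ 0|
  fDot_zero_sep : ∃ c > 0, ∀ θ ∈ S.Θ, c ≤ |S.fDot θ 0|
  y₀_ne : S.y₀ ≠ 0

/-- The deterministic (`ε = 0`) state `y_t(θ)`. -/
def y (t θ : ℝ) : ℝ := S.y₀ * Real.exp (∫ r in 0..t, S.a θ r)

/-- The deterministic (`ε = 0`) observation `x_t(θ)`. -/
def x (t θ : ℝ) : ℝ := ∫ s in 0..t, S.f θ s * S.y s θ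

/-- `x_m(t) = inf_{θ ∈ Θ} x_t(θ)`. -/
def xInf (t : ℝ) : ℝ := sInf (S.x t '' S.Θ)

/-- `x_M(t) = sup_{θ ∈ Θ} x_t(θ)`. -/
def xSup (t : ℝ) : ℝ := sSup (S.x t '' S.Θ)

open Classical in
/-- The endpoint of `Θ` near which `x_t` is small, for small `t`: it is `α` in the normalised case
`y₀ > 0`, `fDot(·,0) > 0`, and in general it is `α` or `β` according to the sign of
`y₀ * fDot(·,0)`. -/
def lowEnd : ℝ := if ∀ θ ∈ S.Θ, 0 < S.y₀ * S.fDot θ 0 then S.α else S.β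

open Classical in
/-- The other endpoint (`β` in the normalised case). -/
def highEnd : ℝ := if ∀ θ ∈ S.Θ, 0 < S.y₀ * S.fDot θ 0 then S.β else S.α

open Classical in
/-- The preliminary estimator based on the observation at time `τ`, as a function of the observed
value `z = X_τ`: the solution `μ ∈ Θ` of `x_τ(μ) = z` if `x_m(τ) < z < x_M(τ)`, and an endpoint
of `Θ` otherwise. -/
def estimator (τ z : ℝ) : ℝ :=
  if z ≤ S.xInf τ then S.lowEnd
  else if S.xSup τ ≤ z then S.highEnd
  else Classical.epsilon fun μ => μ ∈ S.Θ ∧ S.x τ μ = z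

end Model

/-- A step function on `(0,t]`, with value `c i` on `(node i, node (i+1)]` for `i < n`. -/
structure StepFun (t : ℝ) where
  n : ℕ
  node : ℕ → ℝ≥0
  c : ℕ → ℝ
  node_mono : Monotone node
  node_le : ∀ i, (node i : ℝ) ≤ t

namespace StepFun

variable {t : ℝ} (φ : StepFun t)

/-- The step function as a function of time. -/
def toFun (s : ℝ) : ℝ :=
  ∑ i ∈ Finset.range φ.n,
    (Ioc (φ.node i : ℝ) (φ.node (i + 1) : ℝ)).indicator (fun _ => φ.c i) s

/-- The elementary stochastic integral of the step function against the process `W`. -/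
def integral {Ω : Type*} (W : ℝ≥0 → Ω → ℝ) (ω : Ω) : ℝ :=
  ∑ i ∈ Finset.range φ.n, φ.c i * (W (φ.node (i + 1)) ω - W (φ.node i) ω)

end StepFun

/-- `I = ∫₀ᵗ g(s) dW_s` (Wiener integral of a deterministic function): `I` is the limit in `L²(P)`
of the elementary integrals of step functions that converge to `g` in `L²(0,t)`. -/
def IsWienerIntegral {Ω : Type*} [MeasurableSpace Ω] (P : Measure Ω) (W : ℝ≥0 → Ω → ℝ)
    (g : ℝ → ℝ) (t : ℝ) (I : Ω → ℝ) : Prop :=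
  AEStronglyMeasurable I P ∧
  ∃ φ : ℕ → StepFun t,
    Tendsto (fun n => eLpNorm (fun s => (φ n).toFun s - g s) 2 (volume.restrict (Ioc 0 t)))
      atTop (𝓝 0) ∧
    Tendsto (fun n => eLpNorm (fun ω => (φ n).integral W ω - I ω) 2 P) atTop (𝓝 0)

/-- `(X, Y)` solves the partially observed system with parameter `θ` and noise level `ε`, driven by
the independent Wiener processes `W` (observation) and `V` (state), under the probability `P`. -/
structure IsSolution (S : Model) (ε θ : ℝ) {Ω : Type*} [MeasurableSpace Ω] (P : Measure Ω)
    (W V : ℝ≥0 → Ω → ℝ) (X Y : ℝ → Ω → ℝ) : Prop where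
  isProbability : IsProbabilityMeasure P
  wiener_W : IsBrownianReal W P
  wiener_V : IsBrownianReal V P
  indep : IndepFun (fun ω t => W t ω) (fun ω t => V t ω) P
  measurable_X : ∀ t ∈ Icc 0 S.T, Measurable (X t)
  measurable_Y : ∀ t ∈ Icc 0 S.T, Measurable (Y t)
  continuous_X : ∀ᵐ ω ∂P, ContinuousOn (fun t => X t ω) (Icc 0 S.T)
  continuous_Y : ∀ᵐ ω ∂P, ContinuousOn (fun t => Y t ω) (Icc 0 S.T)
  -- `Y_t = y₀ + ∫₀ᵗ a(θ,s) Y_s ds + ∫₀ᵗ ε b(s) dV_s`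
  state_eq : ∀ t ∈ Icc 0 S.T, IsWienerIntegral P V (fun s => ε * S.b s) t
    (fun ω => Y t ω - S.y₀ - ∫ s in 0..t, S.a θ s * Y s ω)
  -- `X_t = ∫₀ᵗ f(θ,s) Y_s ds + ∫₀ᵗ ε σ(s) dW_s`
  obs_eq : ∀ t ∈ Icc 0 S.T, IsWienerIntegral P W (fun s => ε * S.σ s) t
    (fun ω => X t ω - ∫ s in 0..t, S.f θ s * Y s ω)

/-- A family of laws `P ε θ`, one for each noise level `ε > 0` and true value `θ ∈ Θ`, under which
`(X ε θ, Y ε θ)` is a solution of the system with these parameters. -/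
def IsExperiment (S : Model) {Ω : Type*} [MeasurableSpace Ω] (P : ℝ → ℝ → Measure Ω)
    (W V : ℝ → ℝ → ℝ≥0 → Ω → ℝ) (X Y : ℝ → ℝ → ℝ → Ω → ℝ) : Prop :=
  ∀ ε > 0, ∀ θ ∈ S.Θ, IsSolution S ε θ (P ε θ) (W ε θ) (V ε θ) (X ε θ) (Y ε θ)

end HiddenGaussian

end

/-! ### Real analysis -/

/-! The proof compares the size of the noise in `X_τ` with the slope of `θ ↦ x_τ(θ)`.

Noise: `X_τ - x_τ(θ)` is the Wiener integral of `εσ` over `[0,τ]`, of order `ε√τ` in every `L^q`,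
plus `∫ f (Y - y)`. By Grönwall the second term is controlled by the time integral of the absolute
value of the state noise `∫ ε b dV`, of order `ετ√τ`. Hence the whole deviation has `L^q` norm at
most `C ε√τ`, with `C` independent of `θ` (`exists_eLpNorm_sub_x_le`).

Slope: near time `0` the function `y` is close to `y₀` for all parameters, while `f(·,s)` has slope
of fixed sign, bounded away from zero. So `x_τ` is strictly monotone on `Θ` and expands distances by
at least `κτ` (`exists_expanding`). Its inverse is therefore `1/(κτ)`-Lipschitz, and sending values
outside the range to the matching endpoint does not spoil this: `κτ |estimator - θ| ≤ |X_τ -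
x_τ(θ)|` on every path (`mul_abs_estimator_sub_le`).

Dividing, the error is of order `ε√τ / τ = ε/√τ`, uniformly in the true value. Markov's inequality
for the first moment gives consistency, since `ε/√τ = ε^(1 - δ/2)` tends to zero. -/

lemma abs_exp_sub_exp_le {u v M : ℝ} (hu : u ≤ M) (hv : v ≤ M) :
    |Real.exp u - Real.exp v| ≤ Real.exp M * |u - v| := by
  wlog h : v ≤ u generalizing u v
  · rw [abs_sub_comm, abs_sub_comm u]
    exact this hv hu (le_of_not_ge h)
  rw [abs_of_nonneg (sub_nonneg.2 (Real.exp_le_exp.2 h)), abs_of_nonneg (sub_nonneg.2 h)]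
  have h1 : Real.exp v = Real.exp u * Real.exp (v - u) := by rw [← Real.exp_add]; ring_nf
  have h2 := Real.add_one_le_exp (v - u)
  have h3 : Real.exp u ≤ Real.exp M := Real.exp_le_exp.2 hu
  have h4 := Real.exp_pos u
  nlinarith [sub_nonneg.2 h, mul_le_mul_of_nonneg_right h3 (sub_nonneg.2 h)]

lemma intervalIntegrable_of_bounded {g : ℝ → ℝ} {A T s t : ℝ} (hg : Measurable g)
    (hA : ∀ r ∈ Icc 0 T, |g r| ≤ A) (hs : s ∈ Icc 0 T) (ht : t ∈ Icc 0 T) :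
    IntervalIntegrable g volume s t := by
  refine (intervalIntegrable_const (c := A)).mono_fun' hg.aestronglyMeasurable ?_
  rw [EventuallyLE, ae_restrict_iff' measurableSet_uIoc]
  refine ae_of_all _ fun r hr => hA r ?_
  exact uIcc_subset_Icc hs ht (uIoc_subset_uIcc hr)

lemma abs_integral_le_of_bounded {g : ℝ → ℝ} {A T s t : ℝ}
    (hA : ∀ r ∈ Icc 0 T, |g r| ≤ A) (hs : s ∈ Icc 0 T) (ht : t ∈ Icc 0 T) :
    |∫ r in s..t, g r| ≤ A * |t - s| := by
  rw [← Real.norm_eq_abs]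
  refine intervalIntegral.norm_integral_le_of_norm_le_const fun r hr => hA r ?_
  exact uIcc_subset_Icc hs ht (uIoc_subset_uIcc hr)

lemma continuousOn_integral_of_bounded {g : ℝ → ℝ} {A T : ℝ} (hT : 0 ≤ T) (hg : Measurable g)
    (hA : ∀ r ∈ Icc 0 T, |g r| ≤ A) :
    ContinuousOn (fun t => ∫ r in 0..t, g r) (Icc 0 T) := by
  have h := intervalIntegrable_of_bounded hg hA (left_mem_Icc.2 hT) (right_mem_Icc.2 hT)
  have := intervalIntegral.continuousOn_primitive_interval (f := g) (μ := volume) (a := 0) (b := T)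
    (by rw [uIcc_of_le hT]; exact (intervalIntegrable_iff_integrableOn_Icc_of_le hT).1 h)
  rwa [uIcc_of_le hT] at this

/-- The integrand is the a.e. derivative of `exp ∫ g`. As `g` is only bounded and measurable, this
exponential need not be differentiable everywhere; it is Lipschitz, hence absolutely continuous,
which suffices for the fundamental theorem. It is used to show that `y` solves its linear integral
equation. -/
lemma integral_mul_exp_integral {g : ℝ → ℝ} {A t : ℝ} (ht : 0 ≤ t) (hg : Measurable g)
    (hA : ∀ s ∈ Icc 0 t, |g s| ≤ A) :
    ∫ s in 0..t, g s * Real.exp (∫ r in 0..s, g r) = Real.exp (∫ r in 0..t, g r) - 1 := by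
  have hA0 : 0 ≤ A := (abs_nonneg _).trans (hA 0 (left_mem_Icc.2 ht))
  have hi : ∀ u ∈ Icc 0 t, ∀ v ∈ Icc 0 t, IntervalIntegrable g volume u v :=
    fun u hu v hv => intervalIntegrable_of_bounded hg hA hu hv
  have h0 : (0 : ℝ) ∈ Icc 0 t := left_mem_Icc.2 ht
  have htt : t ∈ Icc 0 t := right_mem_Icc.2 ht
  have hub : ∀ u ∈ Icc 0 t, ∫ r in 0..u, g r ≤ A * t := fun u hu =>
    (le_abs_self _).trans ((abs_integral_le_of_bounded hA h0 hu).trans (by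
      rw [sub_zero, abs_of_nonneg hu.1]; gcongr; exact hu.2))
  have hL : LipschitzOnWith (Real.toNNReal (Real.exp (A * t) * A))
      (fun s => Real.exp (∫ r in 0..s, g r)) (uIcc 0 t) := by
    refine LipschitzOnWith.of_dist_le_mul fun u hu v hv => ?_
    rw [uIcc_of_le ht] at hu hv
    rw [Real.dist_eq, Real.dist_eq, Real.coe_toNNReal _ (by positivity), mul_assoc]
    refine (abs_exp_sub_exp_le (hub u hu) (hub v hv)).trans ?_
    gcongr
    rw [intervalIntegral.integral_interval_sub_left (hi 0 h0 u hu) (hi 0 h0 v hv)]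
    exact abs_integral_le_of_bounded hA hv hu
  have h := hL.absolutelyContinuousOnInterval.integral_deriv_eq_sub
  simp only [intervalIntegral.integral_same, Real.exp_zero] at h
  rw [← h]
  refine intervalIntegral.integral_congr_ae ?_
  filter_upwards [(hi 0 h0 t htt).ae_hasDerivAt_integral] with s hs hst
  rw [((hs (uIoc_subset_uIcc hst) 0 left_mem_uIcc).exp).deriv, mul_comm]

/-- Grönwall's inequality, in integrated form. -/
lemma integral_abs_le_of_abs_le_add_integral {D J : ℝ → ℝ} {A τ : ℝ} (hτ : 0 ≤ τ)
    (hD : ContinuousOn D (Icc 0 τ)) (hJ : ContinuousOn J (Icc 0 τ))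
    (h : ∀ t ∈ Icc 0 τ, |D t| ≤ |J t| + A * ∫ s in 0..t, |D s|) (hA : 0 ≤ A) :
    ∫ s in 0..τ, |D s| ≤ Real.exp (A * τ) * ∫ s in 0..τ, |J s| := by
  have key : ∀ (F : ℝ → ℝ), ContinuousOn F (Icc 0 τ) →
      ContinuousOn (fun t => ∫ s in 0..t, F s) (Icc 0 τ) ∧
      ∀ t ∈ Ioo 0 τ, HasDerivAt (fun t => ∫ s in 0..t, F s) (F t) t := by
    intro F hF
    refine ⟨?_, fun t ht => ?_⟩
    · have := intervalIntegral.continuousOn_primitive_interval (f := F) (μ := volume) (a := 0)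
        (b := τ) (by rw [uIcc_of_le hτ]; exact hF.integrableOn_Icc)
      rwa [uIcc_of_le hτ] at this
    · refine intervalIntegral.integral_hasDerivAt_right ?_ ?_ ?_
      · exact (hF.mono (by rw [uIcc_of_le ht.1.le]; exact Icc_subset_Icc_right ht.2.le)
          ).intervalIntegrable
      · exact (hF.mono Ioo_subset_Icc_self).stronglyMeasurableAtFilter isOpen_Ioo t ht
      · exact hF.continuousAt (Icc_mem_nhds ht.1 ht.2)
  obtain ⟨cD, dD⟩ := key _ hD.abs
  obtain ⟨cJ, dJ⟩ := key _ hJ.abs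
  -- The function `∫ |J| - exp(-At) ∫ |D|` vanishes at `0`, and its derivative `|J| - exp(-At) (|D|
  -- - A ∫ |D|)` is at least `(1 - exp(-At)) |J| ≥ 0`. Its nonnegativity at `τ` is the claim.
  have hder : ∀ t ∈ Ioo 0 τ, HasDerivAt
      (fun t => (∫ s in 0..t, |J s|) - Real.exp (-(A * t)) * ∫ s in 0..t, |D s|)
      (|J t| - (Real.exp (-(A * t)) * (-(A * 1)) * (∫ s in 0..t, |D s|) +
        Real.exp (-(A * t)) * |D t|)) t := fun t ht =>
    (dJ t ht).sub ((((hasDerivAt_id t).const_mul A).neg.exp).mul (dD t ht))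
  have mono : MonotoneOn
      (fun t => (∫ s in 0..t, |J s|) - Real.exp (-(A * t)) * ∫ s in 0..t, |D s|) (Icc 0 τ) := by
    refine monotoneOn_of_deriv_nonneg (convex_Icc _ _) ?_ ?_ ?_
    · exact cJ.sub ((Continuous.continuousOn (by fun_prop)).mul cD)
    · rw [interior_Icc]
      exact fun t ht => (hder t ht).differentiableAt.differentiableWithinAt
    · rw [interior_Icc]
      intro t ht
      rw [(hder t ht).deriv]
      have h1 := h t (Ioo_subset_Icc_self ht)
      have h2 : Real.exp (-(A * t)) ≤ 1 := Real.exp_le_one_iff.2 (by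
        have := mul_nonneg hA ht.1.le; linarith)
      have h3 := Real.exp_pos (-(A * t))
      nlinarith [mul_le_mul_of_nonneg_left h1 h3.le,
        mul_le_mul_of_nonneg_right h2 (abs_nonneg (J t))]
  have := mono (left_mem_Icc.2 hτ) (right_mem_Icc.2 hτ) hτ
  simp only [intervalIntegral.integral_same, mul_zero, sub_zero] at this
  have h3 := Real.exp_pos (A * τ)
  have h4 : Real.exp (A * τ) * Real.exp (-(A * τ)) = 1 := by rw [← Real.exp_add]; simp
  calc ∫ s in 0..τ, |D s| = Real.exp (A * τ) * (Real.exp (-(A * τ)) * ∫ s in 0..τ, |D s|) := by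
        rw [← mul_assoc, h4, one_mul]
    _ ≤ _ := by gcongr; linarith

/-- Riemann sums transfer measurability and moment bounds at fixed times to a pathwise time
integral, with no need for joint measurability in time and `ω`. -/
lemma tendsto_riemannSum {g : ℝ → ℝ} {τ : ℝ} (hτ : 0 ≤ τ) (hg : ContinuousOn g (Icc 0 τ)) :
    Tendsto (fun n : ℕ => ∑ i ∈ Finset.range (n + 1), τ / (n + 1) * g (i * (τ / (n + 1))))
      atTop (𝓝 (∫ s in 0..τ, g s)) := by
  rw [Metric.tendsto_atTop]
  intro η hη
  -- The denominator `τ + 1` is positive even for `τ = 0`, and the total error `η τ / (τ + 1)` stays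
  -- strictly below `η`.
  obtain ⟨d, hd, hgd⟩ := Metric.uniformContinuousOn_iff.1
    (isCompact_Icc.uniformContinuousOn_of_continuous hg) (η / (τ + 1)) (by positivity)
  obtain ⟨N, hN⟩ := exists_nat_gt (τ / d)
  refine ⟨N, fun n hn => ?_⟩
  have hn1 : (0 : ℝ) < (n : ℝ) + 1 := by positivity
  have hw : τ / (n + 1) < d := by
    rw [div_lt_iff₀ hd] at hN
    rw [div_lt_iff₀ hn1]
    have : (N : ℝ) ≤ n := by exact_mod_cast hn
    nlinarith
  set w := τ / ((n : ℝ) + 1) with hwdef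
  have hw0 : 0 ≤ w := by positivity
  have hsub : ∀ i ∈ Finset.range (n + 1), (i : ℝ) * w ∈ Icc 0 τ ∧ ((i : ℝ) + 1) * w ∈ Icc 0 τ := by
    intro i hi
    have hi' : (i : ℝ) + 1 ≤ n + 1 := by exact_mod_cast Finset.mem_range.1 hi
    have h1 : ((i : ℝ) + 1) * w ≤ τ := by
      calc ((i : ℝ) + 1) * w ≤ (n + 1) * w := by gcongr
        _ = τ := by rw [hwdef]; field_simp
    exact ⟨⟨by positivity, by nlinarith⟩, ⟨by positivity, h1⟩⟩
  have hint : ∀ i ∈ Finset.range (n + 1),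
      IntervalIntegrable g volume ((i : ℝ) * w) (((i : ℝ) + 1) * w) := fun i hi =>
    (hg.mono (uIcc_subset_Icc (hsub i hi).1 (hsub i hi).2)).intervalIntegrable
  have hsum : ∫ s in 0..τ, g s =
      ∑ i ∈ Finset.range (n + 1), ∫ s in (i : ℝ) * w..((i : ℝ) + 1) * w, g s := by
    have := intervalIntegral.sum_integral_adjacent_intervals (f := g) (μ := volume)
      (a := fun i : ℕ => (i : ℝ) * w) (n := n + 1) (fun k hk => by
        simpa using hint k (Finset.mem_range.2 hk))
    push_cast at this
    rw [this, zero_mul, hwdef]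
    congr 1
    field_simp
  rw [Real.dist_eq, hsum, ← Finset.sum_sub_distrib]
  refine (Finset.abs_sum_le_sum_abs _ _).trans_lt ?_
  have hterm : ∀ i ∈ Finset.range (n + 1),
      |w * g (i * w) - ∫ s in (i : ℝ) * w..((i : ℝ) + 1) * w, g s| ≤ η / (τ + 1) * w := by
    intro i hi
    have h1 : w * g (i * w) = ∫ s in (i : ℝ) * w..((i : ℝ) + 1) * w, g (i * w) := by
      rw [intervalIntegral.integral_const, smul_eq_mul]; ring
    rw [h1, ← intervalIntegral.integral_sub intervalIntegrable_const (hint i hi)]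
    have h2 : |((i : ℝ) + 1) * w - i * w| = w := by
      rw [show ((i : ℝ) + 1) * w - i * w = w by ring, abs_of_nonneg hw0]
    have h3 := intervalIntegral.norm_integral_le_of_norm_le_const
      (f := fun s => g (i * w) - g s) (C := η / (τ + 1)) (a := (i : ℝ) * w)
      (b := ((i : ℝ) + 1) * w) (fun s hs => ?_)
    · rwa [h2] at h3
    · rw [uIoc_of_le (by nlinarith)] at hs
      have hs' : s ∈ Icc 0 τ := ⟨(hsub i hi).1.1.trans hs.1.le, hs.2.trans (hsub i hi).2.2⟩
      have := hgd _ (hsub i hi).1 _ hs' (by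
        rw [Real.dist_eq, abs_sub_comm, abs_of_nonneg (by linarith [hs.1])]
        linarith [hs.2])
      exact this.le
  refine (Finset.sum_le_sum hterm).trans_lt ?_
  rw [Finset.sum_const, Finset.card_range, nsmul_eq_mul]
  push_cast
  calc ((n : ℝ) + 1) * (η / (τ + 1) * w) = η * (τ / (τ + 1)) := by rw [hwdef]; field_simp
    _ < η * 1 := by gcongr; rw [div_lt_one (by positivity)]; linarith
    _ = η := mul_one _

/-! ### Moments of Wiener integrals -/

namespace HiddenGaussian

/-- Scaling: a centred Gaussian of variance `v` has the law of `√v` times a standard one. -/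
lemma eLpNorm_of_hasLaw_gaussianReal {Ω : Type*} [MeasurableSpace Ω] {P : Measure Ω} {Z : Ω → ℝ}
    {v : ℝ≥0} (hZ : HasLaw Z (gaussianReal 0 v) P) (q : ℝ≥0∞) :
    eLpNorm Z q P = eLpNorm id q (gaussianReal 0 1) * ENNReal.ofReal (√v) := by
  have h1 : (gaussianReal 0 1).map (√(v : ℝ) * ·) = gaussianReal 0 v := by
    rw [gaussianReal_map_const_mul]
    congr 1
    · simp
    · ext; simp
  have h2 : eLpNorm Z q P = eLpNorm id q (gaussianReal 0 v) := by
    rw [← hZ.map_eq, eLpNorm_map_measure aestronglyMeasurable_id hZ.aemeasurable]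
    rfl
  rw [h2, ← h1, eLpNorm_map_measure aestronglyMeasurable_id (by fun_prop)]
  have h3 : id ∘ (√(v : ℝ) * ·) = √(v : ℝ) • (id : ℝ → ℝ) := by ext; simp
  rw [h3, eLpNorm_const_smul, mul_comm, Real.enorm_eq_ofReal (Real.sqrt_nonneg _)]

/-- The increments over successive nodes are independent centred Gaussians, so their variances add.
-/
lemma hasLaw_sum_increments {Ω : Type*} [MeasurableSpace Ω] {P : Measure Ω} {W : ℝ≥0 → Ω → ℝ}
    (hW : IsPreBrownianReal W P) {node : ℕ → ℝ≥0} (hnode : Monotone node) (c : ℕ → ℝ) (n : ℕ) :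
    HasLaw (fun ω => ∑ i ∈ Finset.range n, c i * (W (node (i + 1)) ω - W (node i) ω))
      (gaussianReal 0 (∑ i ∈ Finset.range n, ‖c i‖₊ ^ 2 * (node (i + 1) - node i))) P := by
  have hP : IsProbabilityMeasure P := hW.isGaussianProcess.isProbabilityMeasure
  have hlaw : ∀ i, HasLaw (fun ω => c i * (W (node (i + 1)) ω - W (node i) ω))
      (gaussianReal 0 (‖c i‖₊ ^ 2 * (node (i + 1) - node i))) P := by
    intro i
    have hv : ‖c i‖₊ ^ 2 * (node (i + 1) - node i) =
        .mk (c i ^ 2) (sq_nonneg _) * nndist (node (i + 1)).1 (node i).1 := by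
      have := hnode (Nat.le_succ i)
      apply NNReal.eq
      simp only [NNReal.coe_mul, NNReal.coe_pow, coe_nnnorm, Real.norm_eq_abs, sq_abs,
        NNReal.coe_sub this, NNReal.coe_mk, coe_nndist, Real.dist_eq]
      congr 1
      exact (abs_of_nonneg (sub_nonneg.2 (NNReal.coe_le_coe.2 this))).symm
    have h := gaussianReal_const_mul (hW.hasLaw_sub (node (i + 1)) (node i)) (c i)
    rw [mul_zero, ← hv] at h
    exact h
  have hind : iIndepFun (fun i ω => c i * (W (node (i + 1)) ω - W (node i) ω)) P :=
    (hW.hasIndepIncrements.nat hnode).comp (fun i x => c i * x) (fun i => by fun_prop)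
  induction n with
  | zero =>
    refine ⟨by simp, ?_⟩
    simp [gaussianReal_zero_var]
  | succ n ih =>
    have hi := hind.indepFun_finsetSum_of_notMem₀ (fun i => (hlaw i).aemeasurable)
      (s := Finset.range n) (i := n) (by simp)
    have := gaussianReal_add_gaussianReal_of_indepFun hi
      (by convert ih.map_eq using 2; ext; simp) (hlaw n).map_eq
    refine ⟨by
      refine Finset.aemeasurable_fun_sum _ fun i _ => (hlaw i).aemeasurable, ?_⟩
    rw [Finset.sum_range_succ, ← add_zero (0 : ℝ), ← this]
    congr 1
    ext ω
    simp [Finset.sum_range_succ]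

/-- The intervals are disjoint, so at most one summand is nonzero and no cross terms appear. -/
lemma enorm_sum_indicator_sq {node : ℕ → ℝ} (hnode : Monotone node) (c : ℕ → ℝ) (n : ℕ) (s : ℝ) :
    ‖∑ i ∈ Finset.range n, (Ioc (node i) (node (i + 1))).indicator (fun _ => c i) s‖ₑ ^ (2 : ℝ) =
      ∑ i ∈ Finset.range n,
        (Ioc (node i) (node (i + 1))).indicator (fun _ => ‖c i‖ₑ ^ (2 : ℝ)) s := by
  induction n with
  | zero => simp
  | succ n ih =>
    rw [Finset.sum_range_succ, Finset.sum_range_succ]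
    by_cases h : s ∈ Ioc (node n) (node (n + 1))
    · have h0 : ∀ i ∈ Finset.range n, s ∉ Ioc (node i) (node (i + 1)) := fun i hi hs =>
        absurd h.1 (not_lt.2 (hs.2.trans (hnode (Finset.mem_range.1 hi))))
      rw [Finset.sum_eq_zero fun i hi => indicator_of_notMem (h0 i hi) _,
        Finset.sum_eq_zero fun i hi => indicator_of_notMem (h0 i hi) _]
      simp [h]
    · rw [indicator_of_notMem h, indicator_of_notMem h, add_zero, add_zero, ih]

namespace StepFun

variable {t : ℝ} (φ : StepFun t)

lemma measurable_toFun : Measurable φ.toFun := by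
  unfold toFun
  exact Finset.measurable_fun_sum _ fun i _ => measurable_const.indicator measurableSet_Ioc

lemma eLpNorm_toFun :
    eLpNorm φ.toFun 2 (volume.restrict (Ioc 0 t)) = ENNReal.ofReal
      (√(∑ i ∈ Finset.range φ.n, ‖φ.c i‖₊ ^ 2 * (φ.node (i + 1) - φ.node i) : ℝ≥0)) := by
  have hm : Monotone fun i => (φ.node i : ℝ) := fun i j h => NNReal.coe_le_coe.2 (φ.node_mono h)
  rw [eLpNorm_eq_lintegral_rpow_enorm_toReal (by simp) (by simp)]
  simp only [ENNReal.toReal_ofNat, toFun]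
  simp_rw [enorm_sum_indicator_sq hm]
  rw [lintegral_finsetSum _ fun i _ => measurable_const.indicator measurableSet_Ioc]
  have h : ∀ i, ∫⁻ s in Ioc 0 t, (Ioc (φ.node i : ℝ) (φ.node (i + 1))).indicator
      (fun _ => ‖φ.c i‖ₑ ^ (2 : ℝ)) s =
      ((‖φ.c i‖₊ ^ 2 * (φ.node (i + 1) - φ.node i) : ℝ≥0) : ℝ≥0∞) := by
    intro i
    rw [lintegral_indicator measurableSet_Ioc, Measure.restrict_restrict measurableSet_Ioc,
      inter_eq_left.2 (Ioc_subset_Ioc (NNReal.coe_nonneg _) (φ.node_le _)), setLIntegral_const,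
      Real.volume_Ioc, ← NNReal.coe_sub (φ.node_mono (Nat.le_succ i)), ENNReal.ofReal_coe_nnreal,
      ENNReal.coe_mul, ENNReal.coe_pow, ENNReal.rpow_ofNat]
    rfl
  simp_rw [h]
  rw [← ENNReal.ofNNReal_finsetSum, Real.sqrt_eq_rpow, ← ENNReal.ofReal_rpow_of_nonneg
    (NNReal.coe_nonneg _) (by norm_num), ENNReal.ofReal_coe_nnreal]

/-- The Itô isometry for step functions, extended to all exponents: the integral is Gaussian, so its
`L^q` norm is a fixed moment times its standard deviation. -/
lemma eLpNorm_integral {Ω : Type*} [MeasurableSpace Ω] {P : Measure Ω} {W : ℝ≥0 → Ω → ℝ}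
    (hW : IsPreBrownianReal W P) (q : ℝ≥0∞) :
    eLpNorm (φ.integral W) q P =
      eLpNorm id q (gaussianReal 0 1) * eLpNorm φ.toFun 2 (volume.restrict (Ioc 0 t)) := by
  rw [eLpNorm_toFun]
  exact eLpNorm_of_hasLaw_gaussianReal (hasLaw_sum_increments hW φ.node_mono φ.c φ.n) q

lemma aestronglyMeasurable_integral {Ω : Type*} [MeasurableSpace Ω] {P : Measure Ω}
    {W : ℝ≥0 → Ω → ℝ} (hW : IsPreBrownianReal W P) : AEStronglyMeasurable (φ.integral W) P :=
  (hasLaw_sum_increments hW φ.node_mono φ.c φ.n).aemeasurable.aestronglyMeasurable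

end StepFun

/-- The bound holds for the approximating elementary integrals. Their `L²` convergence yields an
a.e. convergent subsequence, and Fatou's lemma carries the `L^q` bound to the limit, so the law of
`I` itself is not needed. -/
lemma IsWienerIntegral.eLpNorm_le {Ω : Type*} [MeasurableSpace Ω] {P : Measure Ω}
    {W : ℝ≥0 → Ω → ℝ} (hW : IsPreBrownianReal W P) {g : ℝ → ℝ} {t : ℝ} {I : Ω → ℝ}
    (hI : IsWienerIntegral P W g t I) (hg : Measurable g) {q : ℝ≥0∞} (hq : q ≠ ∞) :
    eLpNorm I q P ≤
      eLpNorm id q (gaussianReal 0 1) * eLpNorm g 2 (volume.restrict (Ioc 0 t)) := by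
  obtain ⟨hIm, φ, hφ, hφI⟩ := hI
  have hmq : eLpNorm id q (gaussianReal 0 1) ≠ ∞ := (memLp_id_gaussianReal' q hq).eLpNorm_ne_top
  obtain ⟨ns, hns, hae⟩ := (tendstoInMeasure_of_tendsto_eLpNorm (by norm_num)
    (fun n => (φ n).aestronglyMeasurable_integral hW) hIm hφI).exists_seq_tendsto_ae
  refine (Lp.eLpNorm_lim_le_liminf_eLpNorm (p := q)
    (fun n => (φ (ns n)).aestronglyMeasurable_integral hW) I hae).trans ?_
  have hlim : Tendsto (fun n => eLpNorm id q (gaussianReal 0 1) *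
      (eLpNorm (fun s => (φ (ns n)).toFun s - g s) 2 (volume.restrict (Ioc 0 t)) +
        eLpNorm g 2 (volume.restrict (Ioc 0 t)))) atTop
      (𝓝 (eLpNorm id q (gaussianReal 0 1) * (0 + eLpNorm g 2 (volume.restrict (Ioc 0 t))))) :=
    ENNReal.Tendsto.const_mul ((hφ.comp hns.tendsto_atTop).add tendsto_const_nhds) (Or.inr hmq)
  rw [zero_add] at hlim
  rw [← hlim.liminf_eq]
  refine liminf_le_liminf (Eventually.of_forall fun n => ?_)
  rw [StepFun.eLpNorm_integral _ hW]
  gcongr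
  have h := eLpNorm_add_le (μ := volume.restrict (Ioc 0 t)) (p := 2)
    (f := fun s => (φ (ns n)).toFun s - g s) (g := g)
    ((φ (ns n)).measurable_toFun.sub hg).aestronglyMeasurable hg.aestronglyMeasurable (by norm_num)
  rwa [show (fun s => (φ (ns n)).toFun s - g s) + g = (φ (ns n)).toFun by ext s; simp] at h

lemma IsWienerIntegral.eLpNorm_le_of_bound {Ω : Type*} [MeasurableSpace Ω] {P : Measure Ω}
    {W : ℝ≥0 → Ω → ℝ} (hW : IsPreBrownianReal W P) {g : ℝ → ℝ} {t B : ℝ} {I : Ω → ℝ} (ht : 0 ≤ t)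
    (hI : IsWienerIntegral P W g t I) (hg : Measurable g) (hB : ∀ s ∈ Icc 0 t, |g s| ≤ B)
    {q : ℝ≥0∞} (hq : q ≠ ∞) :
    eLpNorm I q P ≤ eLpNorm id q (gaussianReal 0 1) * ENNReal.ofReal (B * √t) := by
  have hB0 : 0 ≤ B := (abs_nonneg _).trans (hB 0 (left_mem_Icc.2 ht))
  refine (hI.eLpNorm_le hW hg hq).trans ?_
  gcongr
  refine (eLpNorm_le_of_ae_bound (C := B) ?_).trans ?_
  · rw [ae_restrict_iff' measurableSet_Ioc]
    exact ae_of_all _ fun s hs => hB s (Ioc_subset_Icc_self hs)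
  · rw [Measure.restrict_apply_univ, Real.volume_Ioc, sub_zero, mul_comm B,
      ENNReal.ofReal_mul (Real.sqrt_nonneg _), Real.sqrt_eq_rpow,
      ← ENNReal.ofReal_rpow_of_nonneg ht (by norm_num)]
    simp

end HiddenGaussian

/-! ### Deviation of the observation from its noise-free limit -/

namespace HiddenGaussian

/-- Minkowski's integral inequality, obtained from the triangle inequality for Riemann sums and
lower semicontinuity of the norm along a.e. limits. The triangle inequality is what requires `1 ≤
q`. -/
lemma eLpNorm_integral_abs_le {Ω : Type*} [MeasurableSpace Ω] {P : Measure Ω} {J : ℝ → Ω → ℝ}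
    {τ : ℝ} {M q : ℝ≥0∞} (hq : 1 ≤ q) (hτ : 0 ≤ τ)
    (hm : ∀ t ∈ Icc 0 τ, AEStronglyMeasurable (J t) P)
    (hc : ∀ᵐ ω ∂P, ContinuousOn (fun t => J t ω) (Icc 0 τ))
    (hM : ∀ t ∈ Icc 0 τ, eLpNorm (J t) q P ≤ M) :
    eLpNorm (fun ω => ∫ s in 0..τ, |J s ω|) q P ≤ ENNReal.ofReal τ * M := by
  have hmem : ∀ n : ℕ, ∀ i ∈ Finset.range (n + 1), (i : ℝ) * (τ / (n + 1)) ∈ Icc 0 τ := by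
    intro n i hi
    have hi' : (i : ℝ) ≤ n + 1 := by exact_mod_cast (Finset.mem_range.1 hi).le
    refine ⟨by positivity, ?_⟩
    calc (i : ℝ) * (τ / (n + 1)) ≤ (n + 1) * (τ / (n + 1)) := by gcongr
      _ = τ := by field_simp
  refine Lp.eLpNorm_le_of_ae_tendsto (u := atTop)
    (f := fun (n : ℕ) ω => ∑ i ∈ Finset.range (n + 1), τ / (n + 1) * |J (i * (τ / (n + 1))) ω|)
    (Eventually.of_forall fun n => ?_) (fun n => ?_) ?_
  · have h1 := eLpNorm_sum_le (μ := P) (p := q) (s := Finset.range (n + 1))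
      (f := fun (i : ℕ) ω => τ / (n + 1) * |J (i * (τ / (n + 1))) ω|)
      (fun i hi => ((hm _ (hmem n i hi)).norm.const_mul _)) hq
    have h2 : (∑ i ∈ Finset.range (n + 1), fun ω => τ / (n + 1) * |J (i * (τ / (n + 1))) ω|) =
        fun ω => ∑ i ∈ Finset.range (n + 1), τ / (n + 1) * |J (i * (τ / (n + 1))) ω| := by
      ext ω; simp
    rw [h2] at h1
    refine h1.trans ?_
    have h3 : ∀ i ∈ Finset.range (n + 1),
        eLpNorm (fun ω => τ / (n + 1) * |J (i * (τ / (n + 1))) ω|) q P ≤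
          ENNReal.ofReal (τ / (n + 1)) * M := by
      intro i hi
      have h4 := eLpNorm_const_smul (τ / ((n : ℝ) + 1)) (fun ω => |J (i * (τ / (n + 1))) ω|) q P
      rw [Real.enorm_eq_ofReal (by positivity)] at h4
      have h5 := eLpNorm_norm (μ := P) (p := q) (J (i * (τ / (n + 1))))
      simp only [Real.norm_eq_abs] at h5
      rw [h5] at h4
      calc _ = _ := h4
        _ ≤ _ := by gcongr; exact hM _ (hmem n i hi)
    refine (Finset.sum_le_sum h3).trans (le_of_eq ?_)
    rw [Finset.sum_const, Finset.card_range, nsmul_eq_mul, ← mul_assoc,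
      ← ENNReal.ofReal_natCast, ← ENNReal.ofReal_mul (by positivity)]
    congr 2
    push_cast
    field_simp
  · exact Finset.aestronglyMeasurable_fun_sum _ fun i hi => (hm _ (hmem n i hi)).norm.const_mul _
  · filter_upwards [hc] with ω hω
    exact tendsto_riemannSum hτ hω.abs

/-- Stability of the linear observation functional under a perturbation of the linear equation
`Y_t = y₀ + ∫₀ᵗ a Y`. -/
lemma abs_integral_mul_sub_le {a f Y : ℝ → ℝ} {A B τ y₀ : ℝ} (hτ : 0 ≤ τ)
    (ha : Measurable a) (hA : ∀ t ∈ Icc 0 τ, |a t| ≤ A)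
    (hf : Measurable f) (hB : ∀ t ∈ Icc 0 τ, |f t| ≤ B) (hY : ContinuousOn Y (Icc 0 τ)) :
    ContinuousOn (fun t => Y t - y₀ - ∫ s in 0..t, a s * Y s) (Icc 0 τ) ∧
    |(∫ s in 0..τ, f s * Y s) - ∫ s in 0..τ, f s * (y₀ * Real.exp (∫ r in 0..s, a r))| ≤
      B * (Real.exp (A * τ) * ∫ t in 0..τ, |Y t - y₀ - ∫ s in 0..t, a s * Y s|) := by
  have h0 : (0 : ℝ) ∈ Icc 0 τ := left_mem_Icc.2 hτ
  have hA0 : 0 ≤ A := (abs_nonneg _).trans (hA 0 h0)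
  have hB0 : 0 ≤ B := (abs_nonneg _).trans (hB 0 h0)
  set y : ℝ → ℝ := fun s => y₀ * Real.exp (∫ r in 0..s, a r) with hy
  have hyc : ContinuousOn y (Icc 0 τ) :=
    continuousOn_const.mul (continuousOn_integral_of_bounded hτ ha hA).rexp
  have hint : ∀ {g F : ℝ → ℝ} {C : ℝ}, Measurable g → (∀ t ∈ Icc 0 τ, |g t| ≤ C) →
      ContinuousOn F (Icc 0 τ) → ∀ t ∈ Icc 0 τ,
      IntervalIntegrable (fun s => g s * F s) volume 0 t := by
    intro g F C hg hC hF t ht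
    exact (intervalIntegrable_of_bounded hg hC h0 ht).mul_continuousOn
      (hF.mono (uIcc_subset_Icc h0 ht))
  have hyeq : ∀ t ∈ Icc 0 τ, y t = y₀ + ∫ s in 0..t, a s * y s := by
    intro t ht
    have h := integral_mul_exp_integral ht.1 ha
      (fun s hs => hA s (Icc_subset_Icc_right ht.2 hs))
    have h2 : ∫ s in 0..t, a s * y s = y₀ * (Real.exp (∫ r in 0..t, a r) - 1) := by
      rw [← h, ← intervalIntegral.integral_const_mul]
      congr 1; ext s; simp only [hy]; ring
    rw [h2]; simp only [hy]; ring
  have hdiff : ∀ {g : ℝ → ℝ} {C : ℝ}, Measurable g → (∀ t ∈ Icc 0 τ, |g t| ≤ C) →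
      ∀ t ∈ Icc 0 τ, |(∫ s in 0..t, g s * Y s) - ∫ s in 0..t, g s * y s| ≤
        C * ∫ s in 0..t, |Y s - y s| := by
    intro g C hg hC t ht
    have hD : ContinuousOn (fun s => Y s - y s) (Icc 0 τ) := hY.sub hyc
    rw [← intervalIntegral.integral_sub (hint hg hC hY t ht) (hint hg hC hyc t ht),
      ← intervalIntegral.integral_const_mul]
    refine intervalIntegral.abs_integral_le_integral_abs ht.1 |>.trans ?_
    refine intervalIntegral.integral_mono_on ht.1
      ((hint hg hC hY t ht).sub (hint hg hC hyc t ht)).abs ?_ fun s hs => ?_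
    · exact ((hD.mono (uIcc_subset_Icc h0 ht)).abs.intervalIntegrable).const_mul C
    · rw [← mul_sub, abs_mul]
      gcongr
      exact hC s (Icc_subset_Icc_right ht.2 hs)
  have hJ : ContinuousOn (fun t => Y t - y₀ - ∫ s in 0..t, a s * Y s) (Icc 0 τ) := by
    refine (hY.sub continuousOn_const).sub ?_
    have := intervalIntegral.continuousOn_primitive_interval (f := fun s => a s * Y s)
      (μ := volume) (a := 0) (b := τ) (by
        rw [uIcc_of_le hτ]
        exact (intervalIntegrable_iff_integrableOn_Icc_of_le hτ).1
          (hint ha hA hY τ (right_mem_Icc.2 hτ)))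
    rwa [uIcc_of_le hτ] at this
  refine ⟨hJ, (hdiff hf hB τ (right_mem_Icc.2 hτ)).trans ?_⟩
  gcongr
  -- Subtracting the equation of `y` gives `Y - y = J + ∫ a (Y - y)`, the setting of Grönwall's
  -- inequality.
  refine integral_abs_le_of_abs_le_add_integral hτ (hY.sub hyc) hJ (fun t ht => ?_) hA0
  have h1 := hdiff ha hA t ht
  have h2 : Y t - y t = (Y t - y₀ - ∫ s in 0..t, a s * Y s) +
      ((∫ s in 0..t, a s * Y s) - ∫ s in 0..t, a s * y s) := by
    rw [hyeq t ht]; ring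
  rw [h2]
  exact (abs_add_le _ _).trans (by gcongr)

/-- Moments of the deviation of the observation from its noise-free counterpart. -/
lemma Model.Regular.exists_eLpNorm_sub_x_le {S : Model} (hS : S.Regular) {q : ℝ≥0∞} (hq : 1 ≤ q)
    (hq' : q ≠ ∞) :
    ∃ C > 0, ∀ (Ω : Type u) [MeasurableSpace Ω] (P : Measure Ω) (W V : ℝ≥0 → Ω → ℝ)
      (X Y : ℝ → Ω → ℝ) (ε θ : ℝ), 0 < ε → θ ∈ S.Θ → IsSolution S ε θ P W V X Y →
      ∀ τ ∈ Icc 0 S.T, eLpNorm (fun ω => X τ ω - S.x τ θ) q P ≤ ENNReal.ofReal (C * (ε * √τ)) := by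
  obtain ⟨Bf, hBf⟩ := hS.bounded_f
  obtain ⟨A, hA⟩ := hS.bounded_a
  obtain ⟨Bσ, hBσ⟩ := hS.bounded_σ
  obtain ⟨Bb, hBb⟩ := hS.bounded_b
  have hT0 : (0 : ℝ) ∈ Icc 0 S.T := left_mem_Icc.2 hS.T_pos.le
  have hBσ0 : 0 ≤ Bσ := (abs_nonneg _).trans (hBσ 0 hT0)
  have hBb0 : 0 ≤ Bb := (abs_nonneg _).trans (hBb 0 hT0)
  have hmq : eLpNorm id q (gaussianReal 0 1) ≠ ∞ := (memLp_id_gaussianReal' q hq').eLpNorm_ne_top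
  set m := (eLpNorm id q (gaussianReal 0 1)).toReal with hm
  have hm0 : 0 ≤ m := ENNReal.toReal_nonneg
  have hmof : eLpNorm id q (gaussianReal 0 1) = ENNReal.ofReal m := (ENNReal.ofReal_toReal hmq).symm
  -- The first summand comes from the observation noise, the second from the state noise; `+ 1`
  -- makes the constant positive. The absolute values provide signs before a parameter `θ` is
  -- available.
  refine ⟨m * Bσ + |Bf| * Real.exp (|A| * S.T) * S.T * (m * Bb) + 1,
    by have := hS.T_pos; positivity, ?_⟩
  intro Ω _ P W V X Y ε θ hε hθ hsol τ hτ
  have hsub : Icc 0 τ ⊆ Icc 0 S.T := Icc_subset_Icc_right hτ.2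
  have hA0 : 0 ≤ A := (abs_nonneg _).trans (hA θ hθ 0 hT0)
  have hBf0 : 0 ≤ Bf := (abs_nonneg _).trans (hBf θ hθ 0 hT0)
  rw [abs_of_nonneg hA0, abs_of_nonneg hBf0]
  set J : ℝ → Ω → ℝ := fun t ω => Y t ω - S.y₀ - ∫ s in 0..t, S.a θ s * Y s ω with hJ
  set I : Ω → ℝ := fun ω => X τ ω - ∫ s in 0..τ, S.f θ s * Y s ω with hI
  have hpath : ∀ᵐ ω ∂P, ContinuousOn (fun t => J t ω) (Icc 0 τ) ∧
      |X τ ω - S.x τ θ| ≤ |I ω| + Bf * Real.exp (A * τ) * ∫ t in 0..τ, |J t ω| := by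
    filter_upwards [hsol.continuous_Y] with ω hω
    have h := abs_integral_mul_sub_le (y₀ := S.y₀) hτ.1 (hS.measurable_a θ hθ)
      (fun t ht => hA θ hθ t (hsub ht)) (hS.measurable_f θ hθ)
      (fun t ht => hBf θ hθ t (hsub ht)) (hω.mono hsub)
    refine ⟨h.1, ?_⟩
    have h2 : X τ ω - S.x τ θ = I ω + ((∫ s in 0..τ, S.f θ s * Y s ω) -
        ∫ s in 0..τ, S.f θ s * (S.y₀ * Real.exp (∫ r in 0..s, S.a θ r))) := by
      simp only [hI, Model.x, Model.y]; ring
    rw [h2, mul_assoc Bf]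
    exact (abs_add_le _ _).trans (by gcongr; exact h.2)
  have hJt : ∀ t ∈ Icc 0 τ, eLpNorm (J t) q P ≤ ENNReal.ofReal (m * (ε * Bb * √τ)) := by
    intro t ht
    refine ((hsol.state_eq t (hsub ht)).eLpNorm_le_of_bound (B := ε * Bb)
      hsol.wiener_V.toIsPreBrownianReal ht.1
      (hS.measurable_b.const_mul ε) (fun s hs => ?_) hq').trans ?_
    · rw [abs_mul, abs_of_pos hε]
      gcongr
      exact hBb s (hsub (Icc_subset_Icc_right ht.2 hs))
    · rw [hmof, ← ENNReal.ofReal_mul hm0]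
      refine ENNReal.ofReal_le_ofReal ?_
      gcongr
      exact ht.2
  have hIq : eLpNorm I q P ≤ ENNReal.ofReal (m * (ε * Bσ * √τ)) := by
    refine ((hsol.obs_eq τ hτ).eLpNorm_le_of_bound (B := ε * Bσ)
      hsol.wiener_W.toIsPreBrownianReal hτ.1
      (hS.measurable_σ.const_mul ε) (fun s hs => ?_) hq').trans ?_
    · rw [abs_mul, abs_of_pos hε]
      gcongr
      exact hBσ s (hsub hs)
    · rw [hmof, ← ENNReal.ofReal_mul hm0]
  have hJint := eLpNorm_integral_abs_le (P := P) (J := J) hq hτ.1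
    (fun t ht => (hsol.state_eq t (hsub ht)).1) (hpath.mono fun ω h => h.1) hJt
  have hJm : AEStronglyMeasurable (fun ω => ∫ t in 0..τ, |J t ω|) P := by
    refine aestronglyMeasurable_of_tendsto_ae (u := atTop)
      (f := fun (n : ℕ) ω => ∑ i ∈ Finset.range (n + 1), τ / (n + 1) * |J (i * (τ / (n + 1))) ω|)
      (fun n => ?_) (hpath.mono fun ω h => tendsto_riemannSum hτ.1 h.1.abs)
    refine Finset.aestronglyMeasurable_fun_sum _ fun i hi =>
      ((hsol.state_eq _ (hsub ⟨by have := hτ.1; positivity, ?_⟩)).1).norm.const_mul _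
    have hi' : (i : ℝ) ≤ n + 1 := by exact_mod_cast (Finset.mem_range.1 hi).le
    calc (i : ℝ) * (τ / (n + 1)) ≤ (n + 1) * (τ / (n + 1)) := by
          have := hτ.1; gcongr
      _ = τ := by field_simp
  calc eLpNorm (fun ω => X τ ω - S.x τ θ) q P
      ≤ eLpNorm ((fun ω => |I ω|) +
          (Bf * Real.exp (A * τ)) • fun ω => ∫ t in 0..τ, |J t ω|) q P :=
        eLpNorm_mono_ae_real (hpath.mono fun ω h => h.2)
    _ ≤ eLpNorm (fun ω => |I ω|) q P +
          eLpNorm ((Bf * Real.exp (A * τ)) • fun ω => ∫ t in 0..τ, |J t ω|) q P :=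
        eLpNorm_add_le (hsol.obs_eq τ hτ).1.norm (hJm.const_smul _) hq
    _ = eLpNorm I q P + ENNReal.ofReal (Bf * Real.exp (A * τ)) *
          eLpNorm (fun ω => ∫ t in 0..τ, |J t ω|) q P := by
        rw [eLpNorm_const_smul, Real.enorm_eq_ofReal (by positivity)]
        congr 1
        exact eLpNorm_norm I
    _ ≤ ENNReal.ofReal (m * (ε * Bσ * √τ)) + ENNReal.ofReal (Bf * Real.exp (A * τ)) *
          (ENNReal.ofReal τ * ENNReal.ofReal (m * (ε * Bb * √τ))) := by gcongr
    _ = ENNReal.ofReal (m * (ε * Bσ * √τ) +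
          Bf * Real.exp (A * τ) * (τ * (m * (ε * Bb * √τ)))) := by
        have := hτ.1
        rw [← ENNReal.ofReal_mul hτ.1, ← ENNReal.ofReal_mul (by positivity),
          ← ENNReal.ofReal_add (by positivity) (by positivity)]
    _ ≤ _ := by
        refine ENNReal.ofReal_le_ofReal ?_
        -- The state noise carries an extra factor `τ`, which may be bounded by `T`: only the order
        -- `ε√τ` matters.
        have h1 : Bf * Real.exp (A * τ) * (τ * (m * (ε * Bb * √τ))) ≤
            Bf * Real.exp (A * S.T) * (S.T * (m * (ε * Bb * √τ))) := by
          have := hτ.1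
          have := hτ.2
          gcongr
        have h2 : 0 ≤ ε * √τ := by positivity
        linarith

end HiddenGaussian

/-! ### Identifiability and the estimator -/

namespace HiddenGaussian

namespace Model

variable {S : Model}

/-- A continuous function on an interval that stays away from zero has constant sign, by the
intermediate value theorem. -/
lemma Regular.exists_sign (hS : S.Regular) : ∃ c > 0,
    (∀ θ ∈ S.Θ, c ≤ S.y₀ * S.fDot θ 0) ∨ (∀ θ ∈ S.Θ, c ≤ -(S.y₀ * S.fDot θ 0)) := by
  obtain ⟨c, hc, h⟩ := hS.fDot_zero_sep
  have hcont : ContinuousOn (fun θ => S.y₀ * S.fDot θ 0) S.Θ := continuousOn_const.mul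
    ((hS.contDiff_f 0 (left_mem_Icc.2 hS.T_pos.le)).continuousOn_deriv_of_isOpen isOpen_Ioo le_rfl)
  have hy : 0 < |S.y₀| := abs_pos.2 hS.y₀_ne
  have hlow : ∀ θ ∈ S.Θ, |S.y₀| * c ≤ |S.y₀ * S.fDot θ 0| := fun θ hθ => by
    rw [abs_mul]; gcongr; exact h θ hθ
  have hpos : 0 < |S.y₀| * c := by positivity
  refine ⟨|S.y₀| * c, hpos, ?_⟩
  by_contra hcon
  push Not at hcon
  obtain ⟨⟨θ, hθ, h1⟩, μ, hμ, h2⟩ := hcon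
  have h3 : S.y₀ * S.fDot θ 0 ≤ 0 := by
    by_contra h4
    have := hlow θ hθ
    rw [abs_of_pos (not_le.1 h4)] at this
    linarith
  have h4 : 0 ≤ S.y₀ * S.fDot μ 0 := by
    by_contra h5
    have := hlow μ hμ
    rw [abs_of_neg (not_le.1 h5)] at this
    linarith
  obtain ⟨ξ, hξ, h0⟩ := (isPreconnected_Ioo.image _ hcont).ordConnected.out
    (mem_image_of_mem _ hθ) (mem_image_of_mem _ hμ) ⟨h3, h4⟩
  have := hlow ξ hξ
  simp only at h0
  rw [h0, abs_zero] at this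
  linarith

lemma Regular.exists_abs_integral_a_le (hS : S.Regular) : ∃ A ≥ 0, ∀ θ ∈ S.Θ, ∀ t ∈ Icc 0 S.T,
    |∫ r in 0..t, S.a θ r| ≤ A := by
  obtain ⟨A, hA⟩ := hS.bounded_a
  refine ⟨|A| * S.T, by have := hS.T_pos; positivity, fun θ hθ t ht => ?_⟩
  refine (abs_integral_le_of_bounded (hA θ hθ) (left_mem_Icc.2 hS.T_pos.le) ht).trans ?_
  rw [sub_zero, abs_of_nonneg ht.1]
  have := ht.1
  gcongr
  · exact le_abs_self A
  · exact ht.2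

lemma Regular.intervalIntegrable_a (hS : S.Regular) {θ t : ℝ} (hθ : θ ∈ S.Θ) (ht : t ∈ Icc 0 S.T) :
    IntervalIntegrable (S.a θ) volume 0 t := by
  obtain ⟨A, hA⟩ := hS.bounded_a
  exact intervalIntegrable_of_bounded (hS.measurable_a θ hθ) (hA θ hθ)
    (left_mem_Icc.2 hS.T_pos.le) ht

lemma Regular.continuousOn_y (hS : S.Regular) {θ : ℝ} (hθ : θ ∈ S.Θ) :
    ContinuousOn (fun t => S.y t θ) (Icc 0 S.T) := by
  obtain ⟨A, hA⟩ := hS.bounded_a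
  exact continuousOn_const.mul
    (continuousOn_integral_of_bounded hS.T_pos.le (hS.measurable_a θ hθ) (hA θ hθ)).rexp

lemma Regular.intervalIntegrable_f_mul_y (hS : S.Regular) {θ t : ℝ} (hθ : θ ∈ S.Θ)
    (ht : t ∈ Icc 0 S.T) : IntervalIntegrable (fun s => S.f θ s * S.y s θ) volume 0 t := by
  obtain ⟨B, hB⟩ := hS.bounded_f
  have h0 : (0 : ℝ) ∈ Icc 0 S.T := left_mem_Icc.2 hS.T_pos.le
  exact (intervalIntegrable_of_bounded (hS.measurable_f θ hθ) (hB θ hθ) h0 ht).mul_continuousOn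
    ((hS.continuousOn_y hθ).mono (uIcc_subset_Icc h0 ht))

/-- All `y` start from the same `y₀`, and the exponents differ by an integral over `[0,t]`. The
resulting factor `t` makes the dependence of `y` on the parameter negligible against that of `f` for
small times. -/
lemma Regular.exists_abs_y_sub_y_le (hS : S.Regular) : ∃ L ≥ 0, ∀ θ ∈ S.Θ, ∀ μ ∈ S.Θ,
    ∀ t ∈ Icc 0 S.T, |S.y t μ - S.y t θ| ≤ L * t * |μ - θ| := by
  obtain ⟨A, hA0, hA⟩ := hS.exists_abs_integral_a_le
  obtain ⟨A', hA'⟩ := hS.bounded_aDot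
  refine ⟨|S.y₀| * (Real.exp A * |A'|), by positivity, fun θ hθ μ hμ t ht => ?_⟩
  have h1 : ∀ s ∈ Icc 0 S.T, |S.a μ s - S.a θ s| ≤ |A'| * |μ - θ| := fun s hs =>
    (convex_Ioo S.α S.β).norm_image_sub_le_of_norm_deriv_le
      (f := fun u => S.a u s) (fun u hu =>
        ((hS.contDiff_a s hs).differentiableOn one_ne_zero).differentiableAt
          (isOpen_Ioo.mem_nhds hu))
      (fun u hu => (hA' u hu s hs).trans (le_abs_self _)) hθ hμ
  have h2 : |(∫ r in 0..t, S.a μ r) - ∫ r in 0..t, S.a θ r| ≤ |A'| * |μ - θ| * t := by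
    rw [← intervalIntegral.integral_sub (hS.intervalIntegrable_a hμ ht)
      (hS.intervalIntegrable_a hθ ht)]
    have := abs_integral_le_of_bounded h1 (left_mem_Icc.2 hS.T_pos.le) ht
    rwa [sub_zero, abs_of_nonneg ht.1] at this
  rw [y, y, ← mul_sub, abs_mul]
  calc _ ≤ |S.y₀| * (Real.exp A * (|A'| * |μ - θ| * t)) := by
        gcongr
        refine (abs_exp_sub_exp_le ((le_abs_self _).trans (hA μ hμ t ht))
          ((le_abs_self _).trans (hA θ hθ t ht))).trans ?_
        gcongr
    _ = _ := by ring

lemma Regular.exists_abs_f_mul_y_le (hS : S.Regular) : ∃ B ≥ 0, ∀ θ ∈ S.Θ, ∀ t ∈ Icc 0 S.T,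
    |S.f θ t * S.y t θ| ≤ B := by
  obtain ⟨A, hA0, hA⟩ := hS.exists_abs_integral_a_le
  obtain ⟨B, hB⟩ := hS.bounded_f
  refine ⟨|B| * (|S.y₀| * Real.exp A), by positivity, fun θ hθ t ht => ?_⟩
  rw [abs_mul, y, abs_mul, Real.abs_exp]
  have h1 := (hB θ hθ t ht).trans (le_abs_self B)
  have h2 := Real.exp_le_exp.2 ((le_abs_self _).trans (hA θ hθ t ht))
  exact mul_le_mul h1 (by gcongr) (by positivity) (abs_nonneg _)

lemma Regular.continuousOn_x (hS : S.Regular) {t : ℝ} (ht : t ∈ Icc 0 S.T) :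
    ContinuousOn (S.x t) S.Θ := by
  obtain ⟨B, hB0, hB⟩ := hS.exists_abs_f_mul_y_le
  obtain ⟨L, hL0, hL⟩ := hS.exists_abs_y_sub_y_le
  have hsub : uIoc 0 t ⊆ Icc 0 S.T := uIoc_subset_uIcc.trans
    (uIcc_subset_Icc (left_mem_Icc.2 hS.T_pos.le) ht)
  intro θ hθ
  have hnhds : S.Θ ∈ 𝓝 θ := isOpen_Ioo.mem_nhds hθ
  refine ContinuousAt.continuousWithinAt ?_
  refine intervalIntegral.continuousAt_of_dominated_interval (bound := fun _ => B) ?_ ?_ ?_ ?_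
  · filter_upwards [hnhds] with μ hμ
    exact (hS.intervalIntegrable_f_mul_y hμ ht).def'.aestronglyMeasurable
  · filter_upwards [hnhds] with μ hμ
    exact ae_of_all _ fun s hs => hB μ hμ s (hsub hs)
  · exact intervalIntegrable_const
  · refine ae_of_all _ fun s hs => ContinuousAt.mul ?_ ?_
    · exact (hS.contDiff_f s (hsub hs)).continuousOn.continuousAt hnhds
    · refine tendsto_iff_norm_sub_tendsto_zero.2 ?_
      refine squeeze_zero' (g := fun μ => L * s * |μ - θ|) (Eventually.of_forall fun μ =>
        norm_nonneg _) ?_ ?_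
      · filter_upwards [hnhds] with μ hμ
        exact hL θ hθ μ hμ s (hsub hs)
      · have : Continuous fun μ => L * s * |μ - θ| := by fun_prop
        have h := this.tendsto θ
        simpa using h

lemma Regular.exists_abs_x_le (hS : S.Regular) : ∃ B, ∀ θ ∈ S.Θ, ∀ t ∈ Icc 0 S.T,
    |S.x t θ| ≤ B := by
  obtain ⟨B, hB0, hB⟩ := hS.exists_abs_f_mul_y_le
  refine ⟨B * S.T, fun θ hθ t ht => ?_⟩
  refine (abs_integral_le_of_bounded (hB θ hθ) (left_mem_Icc.2 hS.T_pos.le) ht).trans ?_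
  rw [sub_zero, abs_of_nonneg ht.1]
  gcongr
  exact ht.2

/-- For small `t`, the map `x_t` is strictly monotone and expands distances by a factor of
order `t`; here `e = ±1` is the direction of the monotonicity. -/
lemma Regular.exists_expanding (hS : S.Regular) {c e : ℝ} (hc : 0 < c) (he : |e| = 1)
    (hsign : ∀ θ ∈ S.Θ, c ≤ e * (S.y₀ * S.fDot θ 0)) :
    ∃ κ > 0, ∃ t₀ > 0, t₀ ≤ S.T ∧ ∀ t ∈ Ioc 0 t₀, ∀ θ ∈ S.Θ, ∀ μ ∈ S.Θ, θ ≤ μ →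
      κ * t * (μ - θ) ≤ e * (S.x t μ - S.x t θ) := by
  obtain ⟨A, hA0, hA⟩ := hS.exists_abs_integral_a_le
  obtain ⟨L, hL0, hL⟩ := hS.exists_abs_y_sub_y_le
  obtain ⟨B, hB⟩ := hS.bounded_f
  obtain ⟨B', hB'⟩ := hS.bounded_fDot'
  have hT := hS.T_pos
  have h0 : (0 : ℝ) ∈ Icc 0 S.T := left_mem_Icc.2 hT.le
  set N := |S.y₀| * |B'| with hN
  have hN0 : 0 ≤ N := by positivity
  set m := Real.exp (-A) with hm
  have hm0 : 0 < m := Real.exp_pos _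
  -- Here `m` bounds `exp ∫ a` from below. The first smallness condition keeps the signed slope `e *
  -- y₀ * fDot` above `c / 2`, so the main term is at least `(c m / 2) (μ - θ)`; the second lets the
  -- variation of `y` cost at most half of this.
  refine ⟨c * m / 4, by positivity,
    min S.T (min (c / (2 * (N + 1))) (c * m / (4 * (|B| * L + 1)))), by positivity,
    min_le_left _ _, ?_⟩
  intro t ht θ hθ μ hμ hθμ
  have ht0 := ht.1
  have htT : t ∈ Icc 0 S.T := ⟨ht.1.le, ht.2.trans (min_le_left _ _)⟩
  have ht1 : N * t ≤ c / 2 := by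
    have h1 := ht.2.trans ((min_le_right _ _).trans (min_le_left _ _))
    rw [le_div_iff₀ (by positivity)] at h1
    nlinarith
  have ht2 : |B| * L * t ≤ c * m / 4 := by
    have h1 := ht.2.trans ((min_le_right _ _).trans (min_le_right _ _))
    rw [le_div_iff₀ (by positivity)] at h1
    nlinarith
  have hsub : Icc 0 t ⊆ Icc 0 S.T := Icc_subset_Icc_right htT.2
  have hdot : ∀ ξ ∈ S.Θ, ∀ s ∈ Icc 0 t, c / 2 ≤ e * S.y₀ * S.fDot ξ s := by
    intro ξ hξ s hs
    have h1 : |S.fDot ξ s - S.fDot ξ 0| ≤ |B'| * |s - 0| :=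
      (convex_Icc 0 S.T).norm_image_sub_le_of_norm_derivWithin_le
        (f := fun s => S.fDot ξ s) ((hS.contDiff_fDot ξ hξ).differentiableOn one_ne_zero)
        (fun r hr => (hB' ξ hξ r hr).trans (le_abs_self _)) h0 (hsub hs)
    rw [sub_zero, abs_of_nonneg hs.1] at h1
    have h2 : |e * S.y₀ * (S.fDot ξ s - S.fDot ξ 0)| ≤ N * s := by
      rw [abs_mul, abs_mul, he, one_mul, hN, mul_assoc]
      gcongr
    have h3 : N * s ≤ N * t := by gcongr; exact hs.2
    have h4 := (abs_le.1 h2).1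
    have h5 := hsign ξ hξ
    linarith
  have hf : ∀ s ∈ Icc 0 t, c / 2 * (μ - θ) ≤ e * S.y₀ * (S.f μ s - S.f θ s) := by
    intro s hs
    rcases hθμ.eq_or_lt with rfl | hlt
    · simp
    have hIcc : Icc θ μ ⊆ S.Θ := fun u hu => ⟨hθ.1.trans_le hu.1, hu.2.trans_lt hμ.2⟩
    have hd := (hS.contDiff_f s (hsub hs)).differentiableOn one_ne_zero
    obtain ⟨ξ, hξ, h1⟩ := exists_deriv_eq_slope (fun u => S.f u s) hlt
      (hd.continuousOn.mono hIcc) (hd.mono (Ioo_subset_Icc_self.trans hIcc))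
    have h2 := hdot ξ (hIcc (Ioo_subset_Icc_self hξ)) s hs
    have h3 : S.fDot ξ s * (μ - θ) = S.f μ s - S.f θ s := by
      rw [fDot, h1, div_mul_cancel₀ _ (sub_pos.2 hlt).ne']
    rw [← h3, ← mul_assoc]
    gcongr
  -- Split `f(μ) y(μ) - f(θ) y(θ)` as `(f(μ) - f(θ)) y(μ) + f(θ) (y(μ) - y(θ))`: main term plus
  -- small correction.
  have hpt : ∀ s ∈ Icc 0 t, c * m / 4 * (μ - θ) ≤
      e * (S.f μ s * S.y s μ - S.f θ s * S.y s θ) := by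
    intro s hs
    have hd0 : 0 ≤ μ - θ := sub_nonneg.2 hθμ
    have hE : m ≤ Real.exp (∫ r in 0..s, S.a μ r) :=
      Real.exp_le_exp.2 (abs_le.1 (hA μ hμ s (hsub hs))).1
    have h1 : c / 2 * (μ - θ) * m ≤
        e * S.y₀ * (S.f μ s - S.f θ s) * Real.exp (∫ r in 0..s, S.a μ r) :=
      mul_le_mul (hf s hs) hE hm0.le (le_trans (by positivity) (hf s hs))
    have h2 : |e * (S.f θ s * (S.y s μ - S.y s θ))| ≤ c * m / 4 * (μ - θ) := by
      rw [abs_mul, he, one_mul, abs_mul]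
      calc _ ≤ |B| * (L * t * (μ - θ)) := by
            refine mul_le_mul ((hB θ hθ s (hsub hs)).trans (le_abs_self _))
              ((hL θ hθ μ hμ s (hsub hs)).trans ?_) (abs_nonneg _) (abs_nonneg _)
            rw [abs_of_nonneg hd0]
            gcongr
            exact hs.2
        _ = |B| * L * t * (μ - θ) := by ring
        _ ≤ _ := by gcongr
    have h3 : e * (S.f μ s * S.y s μ - S.f θ s * S.y s θ) =
        e * S.y₀ * (S.f μ s - S.f θ s) * Real.exp (∫ r in 0..s, S.a μ r) +
          e * (S.f θ s * (S.y s μ - S.y s θ)) := by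
      simp only [y]; ring
    have h4 := (abs_le.1 h2).1
    rw [h3]
    linarith
  have hiμ := hS.intervalIntegrable_f_mul_y hμ htT
  have hiθ := hS.intervalIntegrable_f_mul_y hθ htT
  have := intervalIntegral.integral_mono_on ht.1.le intervalIntegrable_const
    ((hiμ.sub hiθ).const_mul e) hpt
  rw [intervalIntegral.integral_const, intervalIntegral.integral_const_mul,
    intervalIntegral.integral_sub hiμ hiθ, smul_eq_mul, sub_zero] at this
  rw [x, x]
  calc _ = t * (c * m / 4 * (μ - θ)) := by ring
    _ ≤ _ := this

/-- The properties of `x_τ` on which the analysis of the estimator is based. -/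
structure Identifiable (S : Model) (τ k : ℝ) : Prop where
  pos : 0 < k
  continuousOn : ContinuousOn (S.x τ) S.Θ
  bounded : ∃ B, ∀ θ ∈ S.Θ, |S.x τ θ| ≤ B
  nonempty : S.Θ.Nonempty
  expanding : ∀ θ ∈ S.Θ, ∀ μ ∈ S.Θ, k * |θ - μ| ≤ |S.x τ θ - S.x τ μ|
  lowEnd_mem : ∀ θ₀ ∈ S.Θ, S.lowEnd ∈ closure {θ ∈ S.Θ | S.x τ θ ≤ S.x τ θ₀}
  highEnd_mem : ∀ θ₀ ∈ S.Θ, S.highEnd ∈ closure {θ ∈ S.Θ | S.x τ θ₀ ≤ S.x τ θ}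

lemma Regular.exists_identifiable (hS : S.Regular) :
    ∃ κ > 0, ∃ t₀ > 0, t₀ ≤ S.T ∧ ∀ t ∈ Ioc 0 t₀, S.Identifiable t (κ * t) := by
  have hne : S.Θ.Nonempty := nonempty_Ioo.2 hS.α_lt_β
  have hleft : ∀ θ₀ ∈ S.Θ, S.α ∈ closure (Ioo S.α θ₀) := fun θ₀ h => by
    rw [closure_Ioo h.1.ne]; exact left_mem_Icc.2 h.1.le
  have hright : ∀ θ₀ ∈ S.Θ, S.β ∈ closure (Ioo θ₀ S.β) := fun θ₀ h => by
    rw [closure_Ioo h.2.ne]; exact right_mem_Icc.2 h.2.le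
  obtain ⟨B, hB⟩ := hS.exists_abs_x_le
  obtain ⟨c, hc, hsign⟩ := hS.exists_sign
  have hexp : ∀ {κ t e : ℝ}, |e| = 1 → 0 < κ → 0 < t → (∀ θ ∈ S.Θ, ∀ μ ∈ S.Θ, θ ≤ μ →
      κ * t * (μ - θ) ≤ e * (S.x t μ - S.x t θ)) →
      ∀ θ ∈ S.Θ, ∀ μ ∈ S.Θ, κ * t * |θ - μ| ≤ |S.x t θ - S.x t μ| := by
    intro κ t e he hκ ht h θ hθ μ hμ
    wlog hle : θ ≤ μ generalizing θ μ
    · rw [abs_sub_comm, abs_sub_comm (S.x t θ)]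
      exact this μ hμ θ hθ (le_of_not_ge hle)
    rw [abs_sub_comm, abs_of_nonneg (sub_nonneg.2 hle), abs_sub_comm]
    refine (h θ hθ μ hμ hle).trans ((le_abs_self _).trans ?_)
    rw [abs_mul, he, one_mul]
  rcases hsign with hpos | hneg
  · obtain ⟨κ, hκ, t₀, ht₀, htT, h⟩ := hS.exists_expanding (e := 1) hc (by simp)
      (fun θ hθ => by rw [one_mul]; exact hpos θ hθ)
    refine ⟨κ, hκ, t₀, ht₀, htT, fun t ht => ?_⟩
    have htT' : t ∈ Icc 0 S.T := ⟨ht.1.le, ht.2.trans htT⟩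
    have hκt : 0 < κ * t := mul_pos hκ ht.1
    have hif : ∀ θ ∈ S.Θ, 0 < S.y₀ * S.fDot θ 0 := fun θ hθ => hc.trans_le (hpos θ hθ)
    have hmono : ∀ θ ∈ S.Θ, ∀ μ ∈ S.Θ, θ ≤ μ → S.x t θ ≤ S.x t μ := fun θ hθ μ hμ hle => by
      have := (mul_nonneg hκt.le (sub_nonneg.2 hle)).trans (h t ht θ hθ μ hμ hle)
      linarith
    refine ⟨hκt, hS.continuousOn_x htT', ⟨B, fun θ hθ => hB θ hθ t htT'⟩, hne,
      hexp (by simp) hκ ht.1 (h t ht), fun θ₀ h₀ => ?_, fun θ₀ h₀ => ?_⟩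
    · rw [lowEnd, if_pos hif]
      refine closure_mono (fun θ hθ => ?_) (hleft θ₀ h₀)
      have hθ' : θ ∈ S.Θ := ⟨hθ.1, hθ.2.trans h₀.2⟩
      exact ⟨hθ', hmono θ hθ' θ₀ h₀ hθ.2.le⟩
    · rw [highEnd, if_pos hif]
      refine closure_mono (fun θ hθ => ?_) (hright θ₀ h₀)
      have hθ' : θ ∈ S.Θ := ⟨h₀.1.trans hθ.1, hθ.2⟩
      exact ⟨hθ', hmono θ₀ h₀ θ hθ' hθ.1.le⟩
  · obtain ⟨κ, hκ, t₀, ht₀, htT, h⟩ := hS.exists_expanding (e := -1) hc (by simp)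
      (fun θ hθ => by rw [neg_one_mul]; exact hneg θ hθ)
    refine ⟨κ, hκ, t₀, ht₀, htT, fun t ht => ?_⟩
    have htT' : t ∈ Icc 0 S.T := ⟨ht.1.le, ht.2.trans htT⟩
    have hκt : 0 < κ * t := mul_pos hκ ht.1
    have hif : ¬ ∀ θ ∈ S.Θ, 0 < S.y₀ * S.fDot θ 0 := fun hcon => by
      obtain ⟨θ, hθ⟩ := hne
      have h1 := hcon θ hθ
      have h2 := hneg θ hθ
      linarith
    have hanti : ∀ θ ∈ S.Θ, ∀ μ ∈ S.Θ, θ ≤ μ → S.x t μ ≤ S.x t θ := fun θ hθ μ hμ hle => by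
      have := (mul_nonneg hκt.le (sub_nonneg.2 hle)).trans (h t ht θ hθ μ hμ hle)
      linarith
    refine ⟨hκt, hS.continuousOn_x htT', ⟨B, fun θ hθ => hB θ hθ t htT'⟩, hne,
      hexp (by simp) hκ ht.1 (h t ht), fun θ₀ h₀ => ?_, fun θ₀ h₀ => ?_⟩
    · rw [lowEnd, if_neg hif]
      refine closure_mono (fun θ hθ => ?_) (hright θ₀ h₀)
      have hθ' : θ ∈ S.Θ := ⟨h₀.1.trans hθ.1, hθ.2⟩
      exact ⟨hθ', hanti θ₀ h₀ θ hθ' hθ.1.le⟩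
    · rw [highEnd, if_neg hif]
      refine closure_mono (fun θ hθ => ?_) (hleft θ₀ h₀)
      have hθ' : θ ∈ S.Θ := ⟨hθ.1, hθ.2.trans h₀.2⟩
      exact ⟨hθ', hanti θ hθ' θ₀ h₀ hθ.2.le⟩

/-! ### The estimator as a Lipschitz inverse of `x_τ` -/

namespace Identifiable

variable {τ k : ℝ}

lemma xInf_le (h : S.Identifiable τ k) {θ : ℝ} (hθ : θ ∈ S.Θ) : S.xInf τ ≤ S.x τ θ := by
  obtain ⟨B, hB⟩ := h.bounded
  refine csInf_le ⟨-B, ?_⟩ (mem_image_of_mem _ hθ)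
  rintro _ ⟨μ, hμ, rfl⟩
  exact (abs_le.1 (hB μ hμ)).1

lemma le_xSup (h : S.Identifiable τ k) {θ : ℝ} (hθ : θ ∈ S.Θ) : S.x τ θ ≤ S.xSup τ := by
  obtain ⟨B, hB⟩ := h.bounded
  refine le_csSup ⟨B, ?_⟩ (mem_image_of_mem _ hθ)
  rintro _ ⟨μ, hμ, rfl⟩
  exact (abs_le.1 (hB μ hμ)).2

lemma existsUnique (h : S.Identifiable τ k) {z : ℝ} (h1 : S.xInf τ < z) (h2 : z < S.xSup τ) :
    ∃! μ, μ ∈ S.Θ ∧ S.x τ μ = z := by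
  obtain ⟨u, hu, huz⟩ := exists_lt_of_csInf_lt (h.nonempty.image _) h1
  obtain ⟨v, hv, hzv⟩ := exists_lt_of_lt_csSup (h.nonempty.image _) h2
  obtain ⟨μ, hμ, hμz⟩ := (isPreconnected_Ioo.image _ h.continuousOn).ordConnected.out hu hv
    ⟨huz.le, hzv.le⟩
  refine ⟨μ, ⟨hμ, hμz⟩, fun θ ⟨hθ, hθz⟩ => ?_⟩
  have := h.expanding θ hθ μ hμ
  rw [hθz, hμz, sub_self, abs_zero] at this
  have h3 : |θ - μ| ≤ 0 := nonpos_of_mul_nonpos_right this h.pos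
  exact sub_eq_zero.1 (abs_nonpos_iff.1 h3)

lemma estimator_of_le {z : ℝ} (h1 : z ≤ S.xInf τ) : S.estimator τ z = S.lowEnd := if_pos h1

lemma estimator_of_ge {z : ℝ} (h2 : S.xSup τ ≤ z) (h1 : S.xInf τ < z) :
    S.estimator τ z = S.highEnd := by
  rw [estimator, if_neg (not_le.2 h1), if_pos h2]

lemma estimator_spec (h : S.Identifiable τ k) {z : ℝ} (h1 : S.xInf τ < z) (h2 : z < S.xSup τ) :
    S.estimator τ z ∈ S.Θ ∧ S.x τ (S.estimator τ z) = z := by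
  rw [estimator, if_neg (not_le.2 h1), if_neg (not_le.2 h2)]
  exact Classical.epsilon_spec (h.existsUnique h1 h2).exists

/-- Inside the range this is the expansion property. If `z` lies below the range, points `u` of `Θ`
approaching `lowEnd` satisfy `z ≤ x_τ(u) ≤ x_τ(θ)`, so the expansion bound for `u` is at most `|z -
x_τ(θ)|`; the inequality is closed and passes to the endpoint, which is outside `Θ`. The upper case
is symmetric. -/
lemma mul_abs_estimator_sub_le (h : S.Identifiable τ k) (z : ℝ) {θ : ℝ} (hθ : θ ∈ S.Θ) :
    k * |S.estimator τ z - θ| ≤ |z - S.x τ θ| := by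
  have hclosed : ∀ C, IsClosed {u : ℝ | k * |u - θ| ≤ C} := fun C =>
    isClosed_le (by fun_prop) continuous_const
  rcases le_or_gt z (S.xInf τ) with h1 | h1
  · rw [estimator_of_le h1]
    refine closure_minimal (fun u hu => ?_) (hclosed _) (h.lowEnd_mem θ hθ)
    have h3 := h.xInf_le hu.1
    refine (h.expanding u hu.1 θ hθ).trans ?_
    rw [abs_of_nonpos (sub_nonpos.2 hu.2), abs_of_nonpos (by linarith [hu.2])]
    linarith
  rcases le_or_gt (S.xSup τ) z with h2 | h2
  · rw [estimator_of_ge h2 h1]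
    refine closure_minimal (fun u hu => ?_) (hclosed _) (h.highEnd_mem θ hθ)
    have h3 := h.le_xSup hu.1
    refine (h.expanding u hu.1 θ hθ).trans ?_
    rw [abs_of_nonneg (sub_nonneg.2 hu.2), abs_of_nonneg (by linarith [hu.2])]
    linarith
  · obtain ⟨h3, h4⟩ := h.estimator_spec h1 h2
    have := h.expanding _ h3 θ hθ
    rwa [h4] at this

/-- The estimator is in fact `k⁻¹`-Lipschitz in the observed value. -/
lemma measurable_estimator (h : S.Identifiable τ k) : Measurable (S.estimator τ) := by
  have hk := h.pos
  -- Either both values are clipped to the same endpoint, or some `x_τ(θ)` lies between them. In the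
  -- second case the error bounds at `z` and `z'` relative to this `θ` add up to exactly `z' - z`.
  have key : ∀ z z', z ≤ z' →
      S.estimator τ z = S.estimator τ z' ∨ ∃ θ ∈ S.Θ, z ≤ S.x τ θ ∧ S.x τ θ ≤ z' := by
    intro z z' hz
    rcases le_or_gt z (S.xInf τ) with h1 | h1
    · rcases le_or_gt z' (S.xInf τ) with h1' | h1'
      · left; rw [estimator_of_le h1, estimator_of_le h1']
      · right
        rcases le_or_gt (S.xSup τ) z' with h2 | h2
        · obtain ⟨θ, hθ⟩ := h.nonempty
          exact ⟨θ, hθ, h1.trans (h.xInf_le hθ), (h.le_xSup hθ).trans h2⟩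
        · obtain ⟨h3, h4⟩ := h.estimator_spec h1' h2
          exact ⟨_, h3, by rw [h4]; exact hz, h4.le⟩
    · rcases le_or_gt (S.xSup τ) z with h2 | h2
      · left
        rw [estimator_of_ge h2 h1, estimator_of_ge (h2.trans hz) (h1.trans_le hz)]
      · right
        obtain ⟨h3, h4⟩ := h.estimator_spec h1 h2
        exact ⟨_, h3, h4.ge, by rw [h4]; exact hz⟩
  have hlip : ∀ z z', k * |S.estimator τ z - S.estimator τ z'| ≤ |z - z'| := by
    intro z z'
    wlog hz : z ≤ z' generalizing z z'
    · rw [abs_sub_comm, abs_sub_comm z]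
      exact this z' z (le_of_not_ge hz)
    rcases key z z' hz with heq | ⟨θ, hθ, h1, h2⟩
    · rw [heq, sub_self, abs_zero, mul_zero]; exact abs_nonneg _
    · have h3 := h.mul_abs_estimator_sub_le z hθ
      have h4 := h.mul_abs_estimator_sub_le z' hθ
      rw [abs_of_nonpos (by linarith : z - S.x τ θ ≤ 0)] at h3
      rw [abs_of_nonneg (by linarith : 0 ≤ z' - S.x τ θ)] at h4
      rw [abs_of_nonpos (by linarith : z - z' ≤ 0)]
      have h5 := abs_sub_le (S.estimator τ z) θ (S.estimator τ z')
      rw [abs_sub_comm θ] at h5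
      nlinarith
  have : LipschitzWith (Real.toNNReal k⁻¹) (S.estimator τ) :=
    LipschitzWith.of_dist_le_mul fun z z' => by
      rw [Real.dist_eq, Real.dist_eq, Real.coe_toNNReal _ (by positivity),
        ← div_eq_inv_mul, le_div_iff₀ hk, mul_comm]
      exact hlip z z'
  exact this.continuous.measurable

end Identifiable

end Model

end HiddenGaussian

/-! ### Moments of the estimator and the main theorem -/

namespace HiddenGaussian

/-- The exponent `max p 1` reconciles arbitrary `p > 0` with Minkowski's inequality: on a
probability space the `L^p` norm is bounded by the one of larger exponent. -/
lemma lintegral_ofReal_abs_rpow_le {Ω : Type*} [MeasurableSpace Ω] {P : Measure Ω}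
    [IsProbabilityMeasure P] {E Z : Ω → ℝ} {k M p : ℝ} (hp : 0 < p) (hk : 0 < k) (hM : 0 ≤ M)
    (hZm : AEStronglyMeasurable Z P) (hE : ∀ ω, k * |E ω| ≤ |Z ω|)
    (hZ : eLpNorm Z (ENNReal.ofReal (max p 1)) P ≤ ENNReal.ofReal M) :
    ∫⁻ ω, ENNReal.ofReal (|E ω| ^ p) ∂P ≤ ENNReal.ofReal ((M / k) ^ p) := by
  have h1 : ∀ ω, ENNReal.ofReal (|E ω| ^ p) ≤
      ENNReal.ofReal (k⁻¹ ^ p) * ‖Z ω‖ₑ ^ p := by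
    intro ω
    rw [Real.enorm_eq_ofReal_abs, ENNReal.ofReal_rpow_of_nonneg (abs_nonneg _) hp.le,
      ← ENNReal.ofReal_mul (by positivity), ← Real.mul_rpow (by positivity) (abs_nonneg _)]
    refine ENNReal.ofReal_le_ofReal ?_
    gcongr
    rw [inv_mul_eq_div, le_div_iff₀ hk, mul_comm]
    exact hE ω
  have hp0 : ENNReal.ofReal p ≠ 0 := by simpa using hp
  have h2 : ∫⁻ ω, ‖Z ω‖ₑ ^ p ∂P = eLpNorm Z (ENNReal.ofReal p) P ^ p := by
    rw [eLpNorm_eq_lintegral_rpow_enorm_toReal hp0 ENNReal.ofReal_ne_top,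
      ENNReal.toReal_ofReal hp.le, ← ENNReal.rpow_mul, one_div_mul_cancel hp.ne', ENNReal.rpow_one]
  have h3 : eLpNorm Z (ENNReal.ofReal p) P ≤ ENNReal.ofReal M :=
    (eLpNorm_le_eLpNorm_of_exponent_le (ENNReal.ofReal_le_ofReal (le_max_left _ _)) hZm).trans hZ
  calc ∫⁻ ω, ENNReal.ofReal (|E ω| ^ p) ∂P
      ≤ ∫⁻ ω, ENNReal.ofReal (k⁻¹ ^ p) * ‖Z ω‖ₑ ^ p ∂P := lintegral_mono h1
    _ = ENNReal.ofReal (k⁻¹ ^ p) * eLpNorm Z (ENNReal.ofReal p) P ^ p := by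
        rw [lintegral_const_mul' _ _ ENNReal.ofReal_ne_top, h2]
    _ ≤ ENNReal.ofReal (k⁻¹ ^ p) * ENNReal.ofReal M ^ p := by gcongr
    _ = ENNReal.ofReal ((M / k) ^ p) := by
        rw [ENNReal.ofReal_rpow_of_nonneg hM hp.le, ← ENNReal.ofReal_mul (by positivity),
          ← Real.mul_rpow (by positivity) hM, inv_mul_eq_div]

/-- Moment bound for the preliminary estimator, uniform in the true value. -/
lemma Model.Regular.exists_moment_estimator_le {S : Model} (hS : S.Regular) {κ : ℝ} (hκ : 0 < κ)
    {p : ℝ} (hp : 0 < p) :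
    ∃ C > 0, ∀ (Ω : Type u) [MeasurableSpace Ω] (P : Measure Ω) (W V : ℝ≥0 → Ω → ℝ)
      (X Y : ℝ → Ω → ℝ) (ε θ τ : ℝ), 0 < ε → θ ∈ S.Θ → IsSolution S ε θ P W V X Y →
      0 < τ → τ ≤ S.T → S.Identifiable τ (κ * τ) →
      ∫⁻ ω, ENNReal.ofReal (|S.estimator τ (X τ ω) - θ| ^ p) ∂P ≤
        ENNReal.ofReal (C * (ε / √τ) ^ p) := by
  obtain ⟨C, hC, h⟩ := hS.exists_eLpNorm_sub_x_le (q := ENNReal.ofReal (max p 1))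
    (by rw [← ENNReal.ofReal_one]; exact ENNReal.ofReal_le_ofReal (le_max_right _ _))
    ENNReal.ofReal_ne_top
  refine ⟨(C / κ) ^ p, by positivity, ?_⟩
  intro Ω _ P W V X Y ε θ τ hε hθ hsol hτ hτT hid
  have hP := hsol.isProbability
  have hmem : τ ∈ Icc 0 S.T := ⟨hτ.le, hτT⟩
  have hX := hsol.measurable_X τ hmem
  refine (lintegral_ofReal_abs_rpow_le hp hid.pos (by positivity)
    (hX.sub_const (S.x τ θ)).aestronglyMeasurable
    (fun ω => hid.mul_abs_estimator_sub_le (X τ ω) hθ)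
    (h Ω P W V X Y ε θ hε hθ hsol τ hmem)).trans (le_of_eq ?_)
  rw [← Real.mul_rpow (by positivity) (by positivity)]
  congr 2
  have h1 : √τ * √τ = τ := Real.mul_self_sqrt hτ.le
  have h2 : 0 < √τ := Real.sqrt_pos.2 hτ
  rw [div_mul_div_comm, div_eq_div_iff (by positivity) (by positivity)]
  linear_combination C * ε * κ * h1

/-- The function is `ε ^ (1 - δ / 2)`, and the exponent is positive because `δ < 2`. -/
lemma tendsto_div_sqrt_rpow {δ : ℝ} (hδ : δ < 2) :
    Tendsto (fun ε : ℝ => ε / √(ε ^ δ)) (𝓝[>] 0) (𝓝 0) := by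
  have h1 : Tendsto (fun ε : ℝ => ε ^ (1 - δ / 2)) (𝓝[>] 0) (𝓝 0) := by
    have := (Real.continuousAt_rpow_const 0 (1 - δ / 2) (Or.inr (by linarith))).tendsto
    rw [Real.zero_rpow (by linarith)] at this
    exact this.mono_left nhdsWithin_le_nhds
  refine h1.congr' ?_
  filter_upwards [self_mem_nhdsWithin] with ε hε
  have hε' : (0 : ℝ) < ε := hε
  rw [Real.rpow_sub hε', Real.rpow_one, Real.sqrt_eq_rpow, ← Real.rpow_mul hε'.le, mul_one_div]

lemma tendsto_const_mul_div_sqrt_rpow {δ p : ℝ} (hδ : δ < 2) (hp : 0 < p) (C : ℝ) :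
    Tendsto (fun ε : ℝ => C * (ε / √(ε ^ δ)) ^ p) (𝓝[>] 0) (𝓝 0) := by
  have := ((tendsto_div_sqrt_rpow hδ).rpow_const (p := p) (Or.inr hp.le)).const_mul C
  rwa [Real.zero_rpow hp.ne', mul_zero] at this

end HiddenGaussian

theorem theorem1 (S : HiddenGaussian.Model) (hS : S.Regular) (δ : ℝ) (hδ : δ ∈ Set.Ioo (0 : ℝ) 2) :
    ∃ ε₀ > (0 : ℝ),
      -- the estimator is well defined and measurable for small `ε`
      (∀ ε ∈ Set.Ioo 0 ε₀, ε ^ δ ≤ S.T ∧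
        (∀ z, S.xInf (ε ^ δ) < z → z < S.xSup (ε ^ δ) → ∃! μ, μ ∈ S.Θ ∧ S.x (ε ^ δ) μ = z) ∧
        Measurable (S.estimator (ε ^ δ))) ∧
      ∀ K : Set ℝ, IsCompact K → K ⊆ S.Θ →
        -- uniform consistency
        (∀ (Ω : Type u) [MeasurableSpace Ω] (P : ℝ → ℝ → Measure Ω)
            (W V : ℝ → ℝ → ℝ≥0 → Ω → ℝ) (X Y : ℝ → ℝ → ℝ → Ω → ℝ),
          HiddenGaussian.IsExperiment S P W V X Y → ∀ ν > (0 : ℝ),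
          Tendsto (fun ε : ℝ => ⨆ θ₀ ∈ K,
              P ε θ₀ {ω | ν < |S.estimator (ε ^ δ) (X ε θ₀ (ε ^ δ) ω) - θ₀|})
            (𝓝[>] 0) (𝓝 0)) ∧
        -- rate of convergence of the moments
        (∀ p > (0 : ℝ), ∃ C > (0 : ℝ),
          (∀ (Ω : Type u) [MeasurableSpace Ω] (P : ℝ → ℝ → Measure Ω)
              (W V : ℝ → ℝ → ℝ≥0 → Ω → ℝ) (X Y : ℝ → ℝ → ℝ → Ω → ℝ),
            HiddenGaussian.IsExperiment S P W V X Y → ∀ ε ∈ Set.Ioo 0 ε₀,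
            (⨆ θ₀ ∈ K, ∫⁻ ω, ENNReal.ofReal
                (|S.estimator (ε ^ δ) (X ε θ₀ (ε ^ δ) ω) - θ₀| ^ p) ∂(P ε θ₀))
              ≤ ENNReal.ofReal (C * (ε / √(ε ^ δ)) ^ p)) ∧
          Tendsto (fun ε : ℝ => C * (ε / √(ε ^ δ)) ^ p) (𝓝[>] 0) (𝓝 0)) := by
  obtain ⟨κ, hκ, t₀, ht₀, ht₀T, hid⟩ := hS.exists_identifiable
  -- The threshold `t₀ ^ δ⁻¹` for `ε` is the one at which `ε ^ δ` reaches `t₀`.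
  have hsmall : ∀ ε ∈ Set.Ioo 0 (t₀ ^ δ⁻¹), ε ^ δ ∈ Set.Ioc 0 t₀ := by
    intro ε hε
    refine ⟨Real.rpow_pos_of_pos hε.1 _, ?_⟩
    have := Real.rpow_le_rpow hε.1.le hε.2.le hδ.1.le
    rwa [← Real.rpow_mul ht₀.le, inv_mul_cancel₀ hδ.1.ne', Real.rpow_one] at this
  have hε₀ : 0 < t₀ ^ δ⁻¹ := Real.rpow_pos_of_pos ht₀ _
  refine ⟨t₀ ^ δ⁻¹, hε₀, fun ε hε => ?_, fun K _ hK => ⟨?_, fun p hp => ?_⟩⟩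
  · have h := hid _ (hsmall ε hε)
    exact ⟨(hsmall ε hε).2.trans ht₀T, fun z => h.existsUnique, h.measurable_estimator⟩
  · intro Ω _ P W V X Y hexp ν hν
    -- Consistency follows from the first moment by Markov's inequality; `C` does not depend on the
    -- true value, so the bound survives the supremum.
    obtain ⟨C, hC, h⟩ := hS.exists_moment_estimator_le.{u} hκ one_pos
    have hlim : Tendsto (fun ε : ℝ => ENNReal.ofReal (C * (ε / √(ε ^ δ)) ^ (1 : ℝ)) /
        ENNReal.ofReal ν) (𝓝[>] 0) (𝓝 0) := by
      have h1 := ENNReal.tendsto_ofReal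
        (HiddenGaussian.tendsto_const_mul_div_sqrt_rpow hδ.2 one_pos C)
      have h2 := ENNReal.Tendsto.div_const (b := ENNReal.ofReal ν) h1
        (Or.inr (by simpa using hν))
      simpa using h2
    refine tendsto_of_tendsto_of_tendsto_of_le_of_le' tendsto_const_nhds hlim
      (Eventually.of_forall fun _ => zero_le) ?_
    filter_upwards [Ioo_mem_nhdsGT hε₀] with ε hε
    refine iSup₂_le fun θ₀ hθ₀ => ?_
    have hτ := hsmall ε hε
    have hsol := hexp ε hε.1 θ₀ (hK hθ₀)
    have hm : Measurable fun ω =>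
        ENNReal.ofReal (|S.estimator (ε ^ δ) (X ε θ₀ (ε ^ δ) ω) - θ₀| ^ (1 : ℝ)) := by
      have := (hid _ hτ).measurable_estimator.comp
        (hsol.measurable_X _ ⟨hτ.1.le, hτ.2.trans ht₀T⟩)
      simp only [Real.rpow_one]
      exact (this.sub_const θ₀).abs.ennreal_ofReal
    calc P ε θ₀ {ω | ν < |S.estimator (ε ^ δ) (X ε θ₀ (ε ^ δ) ω) - θ₀|}
        ≤ P ε θ₀ {ω | ENNReal.ofReal ν ≤
            ENNReal.ofReal (|S.estimator (ε ^ δ) (X ε θ₀ (ε ^ δ) ω) - θ₀| ^ (1 : ℝ))} := by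
          refine measure_mono fun ω hω => ?_
          rw [Set.mem_ofPred_eq, Real.rpow_one]
          exact ENNReal.ofReal_le_ofReal (le_of_lt hω)
      _ ≤ _ := meas_ge_le_lintegral_div hm.aemeasurable (by simpa using hν) ENNReal.ofReal_ne_top
      _ ≤ _ := by
          gcongr
          exact h Ω _ _ _ _ _ ε θ₀ _ hε.1 (hK hθ₀) hsol hτ.1 (hτ.2.trans ht₀T) (hid _ hτ)
  · obtain ⟨C, hC, h⟩ := hS.exists_moment_estimator_le.{u} hκ hp
    refine ⟨C, hC, fun Ω _ P W V X Y hexp ε hε => ?_,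
      HiddenGaussian.tendsto_const_mul_div_sqrt_rpow hδ.2 hp C⟩
    refine iSup₂_le fun θ₀ hθ₀ => ?_
    have hτ := hsmall ε hε
    exact h Ω _ _ _ _ _ ε θ₀ _ hε.1 (hK hθ₀) (hexp ε hε.1 θ₀ (hK hθ₀)) hτ.1
      (hτ.2.trans ht₀T) (hid _ hτ)
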